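/- For real numbers $\alpha>0$ and $\beta$ put $\rho=\alpha+\beta+1$, and for $\mu\in\mathbb C$ and $t\ge 0$ let $$\varphi^{(\alpha,\beta)}_\mu(t)={}_2F_1\Bigl(\tfrac{\rho-i\mu}{2},\tfrac{\rho+i\mu}{2};\alpha+1;-\sinh^2 t\Bigr)$$ be the Jacobi function, where ${}_2F_1$ denotes the analytic continuation of the Gauss hypergeometric series. There exists a constant $C>0$ such that the following hold for all $\beta\in\{-\tfrac12,0,1\}$, all $\alpha>0$ and all $t\in[0,\infty)$. (1) For all $\lambda\in\mathbb C$, $$\Bigl|\varphi^{(\alpha,\beta)}_{\lambda-i\rho}(t)-(\cosh t)^{i\lambda}\Bigr|\le C\cdot\frac{|\lambda|\,\min(t,1)}{\sqrt\alpha}\cdot e^{|\operatorname{Im}\lambda|\,t}.$$ (2) For all $\lambda\in\mathbb C$ with $\operatorname{Im}\lambda\in[0,2\rho]$, $$\Bigl|\varphi^{(\alpha,\beta)}_{\lambda-i\rho}(t)-(\cosh t)^{i\lambda}\Bigr|\le C\cdot\frac{|\lambda|\,\min(t,1)}{\sqrt\alpha}.$$ -/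

import Mathlib

open Filter Topology

/-- The analytic continuation of the Gauss hypergeometric function `z ↦ ₂F₁(a, b; c; z)` from the
unit disc to the half plane `Re z < 1/2`, for `c ≠ 0, -1, -2, …`. Mathlib's `₂F₁` is the sum of the
power series, with junk values outside the disc of convergence, so the continuation is written with
Pfaff's transformation; `z / (z - 1)` lies in the unit disc exactly when `Re z < 1/2`.
`gaussHypergeometric_eq` and `gaussHypergeometric_analyticOnNhd` below prove that this is indeed
the analytic continuation of the power series. -/
noncomputable def gaussHypergeometric (a b c z : ℂ) : ℂ :=
  (1 - z) ^ (-a) * ₂F₁ a (c - b) c (z / (z - 1))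

theorem ascPoch_succ (x : ℂ) (n : ℕ) : (ascPochhammer ℂ (n + 1)).eval x =
    x * (ascPochhammer ℂ n).eval (x + 1) := by
  induction n with
  | zero => simp
  | succ n ih => rw [ascPochhammer_succ_eval, ih, ascPochhammer_succ_eval]; push_cast; ring

theorem ascPoch_add (x : ℂ) (n k : ℕ) : (ascPochhammer ℂ (n + k)).eval x =
    (ascPochhammer ℂ n).eval x * (ascPochhammer ℂ k).eval (x + n) := by
  induction k with
  | zero => simp
  | succ k ih =>
    rw [← add_assoc, ascPochhammer_succ_eval, ih, ascPochhammer_succ_eval]; push_cast; ring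

theorem ascPoch_ne_zero {c : ℂ} (hc : ∀ k : ℕ, c ≠ -k) (n : ℕ) : (ascPochhammer ℂ n).eval c ≠ 0 := by
  induction n with
  | zero => simp
  | succ n ih =>
    rw [ascPochhammer_succ_eval]
    exact mul_ne_zero ih fun h => hc n (eq_neg_of_add_eq_zero_left h)

theorem chuVandermonde (m : ℕ) : ∀ c d : ℂ, (∀ k : ℕ, c ≠ -k) →
    ∑ n ∈ Finset.range (m + 1), (m.choose n : ℂ) * (-1) ^ n * (ascPochhammer ℂ n).eval d *
      ((ascPochhammer ℂ n).eval c)⁻¹ =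
    (ascPochhammer ℂ m).eval (c - d) * ((ascPochhammer ℂ m).eval c)⁻¹ := by
  induction m with
  | zero => intro c d _; simp
  | succ m ih =>
    intro c d hc
    have hc' : ∀ k : ℕ, c + 1 ≠ -k := fun k h => hc (k + 1) (by push_cast; linear_combination h)
    have h1 := ih c d hc
    have h2 := ih (c + 1) (d + 1) hc'
    have hc0 : c ≠ 0 := by simpa using hc 0
    rw [Finset.sum_range_succ'] 
    have e : ∀ n : ℕ, (((m + 1).choose (n + 1) : ℕ) : ℂ) * (-1) ^ (n + 1) *
        (ascPochhammer ℂ (n + 1)).eval d * ((ascPochhammer ℂ (n + 1)).eval c)⁻¹ =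
        -(d * c⁻¹) * ((m.choose n : ℂ) * (-1) ^ n * (ascPochhammer ℂ n).eval (d + 1) *
          ((ascPochhammer ℂ n).eval (c + 1))⁻¹) +
        (m.choose (n + 1) : ℂ) * (-1) ^ (n + 1) * (ascPochhammer ℂ (n + 1)).eval d *
          ((ascPochhammer ℂ (n + 1)).eval c)⁻¹ := by
      intro n
      rw [ascPoch_succ d, ascPoch_succ c, Nat.choose_succ_succ, mul_inv]
      push_cast; ring
    simp_rw [e]
    rw [Finset.sum_add_distrib, ← Finset.mul_sum, h2, add_assoc]
    have h3 : ∑ n ∈ Finset.range (m + 1), (m.choose (n + 1) : ℂ) * (-1) ^ (n + 1) *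
        (ascPochhammer ℂ (n + 1)).eval d * ((ascPochhammer ℂ (n + 1)).eval c)⁻¹ + 1 =
        (ascPochhammer ℂ m).eval (c - d) * ((ascPochhammer ℂ m).eval c)⁻¹ := by
      rw [← h1, Finset.sum_range_succ, Finset.sum_range_succ' _ m]
      simp
    simp only [Nat.choose_zero_right, pow_zero, ascPochhammer_zero, Polynomial.eval_one,
      Nat.cast_one, inv_one, mul_one]
    rw [h3, show c + 1 - (d + 1) = c - d by ring, ascPochhammer_succ_eval (k := c - d)]
    have p1 := ascPoch_ne_zero hc m
    have p2 := ascPoch_ne_zero hc' m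
    have p3 := ascPoch_ne_zero hc (m + 1)
    have q1 := ascPoch_succ c m
    have q2 := ascPochhammer_succ_eval (S := ℂ) m c
    have p4 : c + m ≠ 0 := fun h => hc m (eq_neg_of_add_eq_zero_left h)
    have q3 : (ascPochhammer ℂ m).eval (c + 1) =
      (ascPochhammer ℂ m).eval c * (c + m) / c := by
      rw [eq_div_iff hc0]; linear_combination q2 - q1
    rw [q2, q3]
    field_simp
    ring

theorem ratio_bound {c d : ℂ} (_hc : ∀ k : ℕ, c ≠ -k) : ∃ A : ℝ, 0 < A ∧ ∀ n : ℕ,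
    ‖(ascPochhammer ℂ n).eval d * ((ascPochhammer ℂ n).eval c)⁻¹‖ ≤ A ^ n := by
  have h : Tendsto (fun k : ℕ => (d + k) / (c + k)) atTop (𝓝 1) := by
    simpa using tendsto_add_mul_div_add_mul_atTop_nhds d c (1 : ℂ) one_ne_zero
  obtain ⟨A, hA⟩ := h.norm.bddAbove_range
  refine ⟨max A 1, by positivity, fun n => ?_⟩
  induction n with
  | zero => simp
  | succ n ih =>
    rw [ascPochhammer_succ_eval, ascPochhammer_succ_eval, pow_succ]
    have : (ascPochhammer ℂ n).eval d * (d + n) * ((ascPochhammer ℂ n).eval c * (c + n))⁻¹ =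
      ((ascPochhammer ℂ n).eval d * ((ascPochhammer ℂ n).eval c)⁻¹) * ((d + n) / (c + n)) := by
      rw [mul_inv]; ring
    rw [this, norm_mul]
    exact mul_le_mul ih ((hA ⟨n, rfl⟩).trans (le_max_left _ _)) (norm_nonneg _) (by positivity)

theorem hasSum_binom (a : ℂ) {z : ℂ} (hz : ‖z‖ < 1) :
    HasSum (fun k : ℕ => (ascPochhammer ℂ k).eval a * ((k.factorial : ℂ))⁻¹ * z ^ k)
      ((1 - z) ^ (-a)) := by
  have h := (Complex.one_div_one_sub_cpow_hasFPowerSeriesOnBall_zero a).hasSum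
    (y := z) (by simpa [enorm_eq_nnnorm] using! hz)
  simp only [FormalMultilinearSeries.ofScalars_apply_eq, zero_add, smul_eq_mul] at h
  rw [Complex.cpow_neg, ← one_div]
  convert! h using 2 with k
  rw [← Ring.multichoose_eq]
  have := Ring.factorial_nsmul_multichoose_eq_ascPochhammer a k
  rw [Polynomial.ascPochhammer_smeval_cast, Polynomial.ascPochhammer_smeval_eq_eval, nsmul_eq_mul] at this
  rw [← this]
  have : (k.factorial : ℂ) ≠ 0 := by exact_mod_cast k.factorial_ne_zero
  field_simp

theorem pfaff_small (a b : ℂ) {c : ℂ} (hc : ∀ k : ℕ, c ≠ -k) :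
    ∀ᶠ z : ℂ in 𝓝 0, gaussHypergeometric a b c z = ₂F₁ a b c z := by
  set d := c - b with hd
  obtain ⟨A, hA0, hA⟩ := ratio_bound (d := d) hc
  have hev : ∀ᶠ z : ℂ in 𝓝 0, ‖z * (1 + A)‖ < 1 := by
    have : Continuous fun z : ℂ => ‖z * (1 + A)‖ := by fun_prop
    exact this.continuousAt.eventually_lt continuousAt_const (by simp)
  filter_upwards [hev] with z hz
  have hz1 : ‖z‖ < 1 := by
    have h1 : ‖(1 + A : ℂ)‖ = 1 + A := by
      rw [← Complex.ofReal_one, ← Complex.ofReal_add, Complex.norm_real]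
      exact abs_of_pos (by linarith)
    rw [norm_mul, h1] at hz
    nlinarith [norm_nonneg z]
  have hzne : 1 - z ≠ 0 := by
    intro h
    have : z = 1 := by linear_combination -h
    simp [this] at hz1
  let P : ℂ → ℕ → ℂ := fun x n => (ascPochhammer ℂ n).eval x
  let R : ℕ → ℂ := fun n => P d n * (P c n)⁻¹
  let f : ℕ × ℕ → ℂ := fun q =>
    (P a (q.1 + q.2) * z ^ (q.1 + q.2)) * ((q.1.factorial : ℂ)⁻¹ * (q.2.factorial : ℂ)⁻¹ *
      ((-1) ^ q.1 * R q.1))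
  have key : ∀ m : ℕ, ∀ q ∈ Finset.HasAntidiagonal.antidiagonal m, ((q.1.factorial : ℂ)⁻¹ * (q.2.factorial : ℂ)⁻¹)
      = (m.factorial : ℂ)⁻¹ * (m.choose q.1 : ℂ) := by
    intro m q hq
    rw [Finset.HasAntidiagonal.mem_antidiagonal] at hq
    subst hq
    have h1 : ((q.1 + q.2).choose q.1 : ℂ) * q.1.factorial * q.2.factorial =
        (q.1 + q.2).factorial := by
      rw [Nat.choose_symm_add]
      exact_mod_cast Nat.add_choose_mul_factorial_mul_factorial q.1 q.2
    have e1 : (q.1.factorial : ℂ) ≠ 0 := by exact_mod_cast q.1.factorial_ne_zero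
    have e2 : (q.2.factorial : ℂ) ≠ 0 := by exact_mod_cast q.2.factorial_ne_zero
    have e3 : ((q.1 + q.2).factorial : ℂ) ≠ 0 := by exact_mod_cast (q.1 + q.2).factorial_ne_zero
    field_simp
    linear_combination -h1
  have hsum : Summable f := by
    rw [← Finset.HasAntidiagonal.sigmaAntidiagonalEquivProd.summable_iff]
    apply Summable.of_norm
    rw [summable_sigma_of_nonneg (fun _ => norm_nonneg _)]
    refine ⟨fun m => (hasSum_fintype _).summable, ?_⟩
    refine Summable.of_nonneg_of_le (fun m => tsum_nonneg fun _ => norm_nonneg _) (fun m => ?_)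
      (hasSum_binom a hz).summable.norm
    rw [tsum_fintype]
    change ∑ q : Finset.HasAntidiagonal.antidiagonal m, ‖f q‖ ≤ _
    rw [Finset.sum_coe_sort (Finset.HasAntidiagonal.antidiagonal m) fun q => ‖f q‖]
    calc ∑ q ∈ Finset.HasAntidiagonal.antidiagonal m, ‖f q‖
        ≤ ∑ q ∈ Finset.HasAntidiagonal.antidiagonal m, ‖P a m * z ^ m * (m.factorial : ℂ)⁻¹‖ *
            ((m.choose q.1 : ℝ) * A ^ q.1) := by
          refine Finset.sum_le_sum fun q hq => ?_
          have hq' := Finset.HasAntidiagonal.mem_antidiagonal.1 hq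
          have : f q = (P a m * z ^ m * (m.factorial : ℂ)⁻¹) *
              ((m.choose q.1 : ℂ) * ((-1) ^ q.1 * R q.1)) := by
            simp only [f]
            rw [key m q hq, hq']; ring
          rw [this, norm_mul, norm_mul (m.choose q.1 : ℂ), norm_mul ((-1 : ℂ) ^ q.1), Complex.norm_natCast]
          have hR : ‖R q.1‖ ≤ A ^ q.1 := hA q.1
          simp only [norm_pow, norm_neg, norm_one, one_pow, one_mul]
          gcongr
      _ = ‖P a m * z ^ m * (m.factorial : ℂ)⁻¹‖ * (1 + A) ^ m := by
          rw [← Finset.mul_sum, Finset.Nat.sum_antidiagonal_eq_sum_range_succ_mk, add_comm 1 A,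
            add_pow]
          congr 1
          exact Finset.sum_congr rfl fun n _ => by simp; ring
      _ = _ := by
          have h1 : ‖(1 + A : ℂ)‖ = 1 + A := by
            rw [← Complex.ofReal_one, ← Complex.ofReal_add, Complex.norm_real]
            exact abs_of_pos (by linarith)
          simp only [norm_mul, norm_pow, h1, P, mul_pow]
          ring
  have h1 : ∑' q, f q = gaussHypergeometric a b c z := by
    rw [hsum.tsum_prod, gaussHypergeometric, ordinaryHypergeometric_eq_tsum, ← tsum_mul_left]
    refine tsum_congr fun n => ?_
    have hb := (hasSum_binom (a + n) hz1).mul_left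
      (P a n * z ^ n * ((n.factorial : ℂ)⁻¹ * ((-1) ^ n * R n)))
    have : (fun k => f (n, k)) = fun k => (P a n * z ^ n * ((n.factorial : ℂ)⁻¹ *
        ((-1) ^ n * R n))) * ((ascPochhammer ℂ k).eval (a + n) * ((k.factorial : ℂ))⁻¹ * z ^ k) := by
      funext k
      simp only [f, P]
      rw [ascPoch_add, pow_add]; ring
    rw [this, hb.tsum_eq, neg_add, Complex.cpow_add _ _ hzne, Complex.cpow_neg _ (n : ℂ),
      Complex.cpow_natCast, smul_eq_mul, show z / (z - 1) = (-1) * z * (1 - z)⁻¹ by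
        rw [← neg_sub 1 z, div_neg, div_eq_mul_inv]; ring]
    simp only [P, R, mul_pow, inv_pow]
    ring
  have h2 : ∑' q, f q = ₂F₁ a b c z := by
    rw [← Finset.HasAntidiagonal.sigmaAntidiagonalEquivProd.tsum_eq f]
    change ∑' p, (f ∘ Finset.HasAntidiagonal.sigmaAntidiagonalEquivProd) p = _
    rw [Summable.tsum_sigma' (f := f ∘ Finset.HasAntidiagonal.sigmaAntidiagonalEquivProd)
      (fun m => (hasSum_fintype _).summable)
      ((Finset.HasAntidiagonal.sigmaAntidiagonalEquivProd.summable_iff).2 hsum), ordinaryHypergeometric_eq_tsum]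
    refine tsum_congr fun m => ?_
    rw [tsum_fintype]
    change ∑ q : Finset.HasAntidiagonal.antidiagonal m, f q = _
    rw [Finset.sum_coe_sort (Finset.HasAntidiagonal.antidiagonal m) f]
    have h3 := chuVandermonde m c d hc
    rw [hd, sub_sub_cancel, ← hd] at h3
    have : ∑ q ∈ Finset.HasAntidiagonal.antidiagonal m, f q = ∑ q ∈ Finset.HasAntidiagonal.antidiagonal m,
        (P a m * z ^ m * (m.factorial : ℂ)⁻¹) * ((m.choose q.1 : ℂ) * ((-1) ^ q.1 * R q.1)) := by
      refine Finset.sum_congr rfl fun q hq => ?_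
      simp only [f]
      rw [key m q hq, Finset.HasAntidiagonal.mem_antidiagonal.1 hq]; ring
    rw [this, ← Finset.mul_sum, Finset.Nat.sum_antidiagonal_eq_sum_range_succ_mk]
    have h4 : ∑ n ∈ Finset.range (m + 1), (m.choose n : ℂ) * ((-1) ^ n * R n) =
        P b m * (P c m)⁻¹ := by
      rw [← h3]
      exact Finset.sum_congr rfl fun n _ => by simp only [R, P]; ring
    simp only [Nat.succ_eq_add_one]
    rw [h4]
    simp only [P, smul_eq_mul]; ring
  rw [← h1, h2]

theorem one_le_radius (a b : ℂ) {c : ℂ} (hc : ∀ k : ℕ, c ≠ -k) :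
    1 ≤ (ordinaryHypergeometricSeries ℂ a b c).radius := by
  by_cases ha : ∃ k : ℕ, a = -k
  · obtain ⟨k, rfl⟩ := ha
    simp [ordinaryHypergeometric_radius_top_of_neg_nat₁]
  by_cases hb : ∃ k : ℕ, b = -k
  · obtain ⟨k, rfl⟩ := hb
    simp [ordinaryHypergeometric_radius_top_of_neg_nat₂]
  push Not at ha hb
  rw [ordinaryHypergeometricSeries_radius_eq_one]
  exact fun k => ⟨fun h => ha k (by rw [h, neg_neg]), fun h => hb k (by rw [h, neg_neg]),
    fun h => hc k (by rw [h, neg_neg])⟩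

theorem analyticOn_2F1 (a b : ℂ) {c : ℂ} (hc : ∀ k : ℕ, c ≠ -k) :
    AnalyticOnNhd ℂ (₂F₁ a b c : ℂ → ℂ) (Metric.ball 0 1) := by
  have hr := one_le_radius a b hc
  have h := (ordinaryHypergeometricSeries ℂ a b c).hasFPowerSeriesOnBall
    (lt_of_lt_of_le one_pos hr)
  intro z hz
  refine h.analyticAt_of_mem ?_
  rw [Metric.mem_eball, edist_zero_right]
  refine lt_of_lt_of_le ?_ hr
  simpa [enorm_eq_nnnorm] using! hz

/-- The continuation is holomorphic on `Re z < 1/2`. -/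
theorem gaussHypergeometric_analyticOnNhd (a b : ℂ) {c : ℂ} (hc : ∀ k : ℕ, c ≠ -k) :
    AnalyticOnNhd ℂ (gaussHypergeometric a b c) {z | z.re < 1 / 2} := by
  intro z hz
  have hz : z.re < 1 / 2 := hz
  have hne : z - 1 ≠ 0 := by
    intro h
    have : z = 1 := by linear_combination h
    rw [this] at hz
    norm_num at hz
  have hslit : 1 - z ∈ Complex.slitPlane := by
    left; simp; linarith
  have hb : z / (z - 1) ∈ Metric.ball (0 : ℂ) 1 := by
    rw [mem_ball_zero_iff, norm_div, div_lt_one (norm_pos_iff.2 hne)]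
    rw [← sq_lt_sq₀ (norm_nonneg _) (norm_nonneg _), Complex.sq_norm, Complex.sq_norm,
      Complex.normSq_apply, Complex.normSq_apply]
    simp; nlinarith
  have h1 : AnalyticAt ℂ (fun z : ℂ => (1 - z) ^ (-a)) z :=
    (analyticAt_const.sub analyticAt_id).cpow analyticAt_const hslit
  have h2 : AnalyticAt ℂ (fun z : ℂ => z / (z - 1)) z :=
    analyticAt_id.div (analyticAt_id.sub analyticAt_const) hne
  exact h1.mul (AnalyticAt.comp (g := (₂F₁ a (c - b) c : ℂ → ℂ)) (f := fun z : ℂ => z / (z - 1))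
    (analyticOn_2F1 a (c - b) hc _ hb) h2)

/-- On the common domain the continuation agrees with the power series. -/
theorem gaussHypergeometric_eq (a b : ℂ) {c z : ℂ} (hc : ∀ k : ℕ, c ≠ -k) (hz : ‖z‖ < 1)
    (hz' : z.re < 1 / 2) : gaussHypergeometric a b c z = ₂F₁ a b c z := by
  have hconv : Convex ℝ (Metric.ball (0 : ℂ) 1 ∩ {z | z.re < 1 / 2}) :=
    (convex_ball _ _).inter (convex_halfSpace_re_lt _)
  refine AnalyticOnNhd.eqOn_of_preconnected_of_eventuallyEq
    ((gaussHypergeometric_analyticOnNhd a b hc).mono Set.inter_subset_right)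
    ((analyticOn_2F1 a b hc).mono Set.inter_subset_left) hconv.isPreconnected
    (z₀ := 0) ?_ (pfaff_small a b hc) ?_
  · simp
  · exact ⟨by simpa using hz, hz'⟩

/-- `ρ = α + β + 1`. -/
noncomputable def jacobiRho (α β : ℝ) : ℝ := α + β + 1

/-- The Jacobi function
`φ_μ^{(α,β)}(t) = ₂F₁((ρ - iμ)/2, (ρ + iμ)/2; α + 1; -sinh² t)` with `ρ = α + β + 1`. -/
noncomputable def jacobiFunction (α β : ℝ) (μ : ℂ) (t : ℝ) : ℂ :=
  gaussHypergeometric ((jacobiRho α β - Complex.I * μ) / 2) ((jacobiRho α β + Complex.I * μ) / 2) (α + 1)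
    (-((Real.sinh t : ℂ) ^ 2))

theorem ne_neg_nat {α : ℝ} (hα : -1 < α) (k : ℕ) : (α + 1 : ℂ) ≠ -k := by
  intro h
  have h1 : α + 1 = -(k : ℝ) := by exact_mod_cast h
  have : (0 : ℝ) ≤ k := k.cast_nonneg
  linarith

theorem neg_sq_re (x : ℝ) : (-((x : ℂ) ^ 2)).re < 1 / 2 := by
  rw [← Complex.ofReal_pow, ← Complex.ofReal_neg, Complex.ofReal_re]
  nlinarith [sq_nonneg x]

/-- For `|sinh t| < 1` the Jacobi function is the value of the hypergeometric power series. -/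
theorem jacobiFunction_eq {α : ℝ} (hα : -1 < α) (β : ℝ) (μ : ℂ) {t : ℝ} (ht : |Real.sinh t| < 1) :
    jacobiFunction α β μ t =
      ₂F₁ ((jacobiRho α β - Complex.I * μ) / 2) ((jacobiRho α β + Complex.I * μ) / 2) (α + 1 : ℂ)
        (-((Real.sinh t : ℂ) ^ 2)) := by
  refine gaussHypergeometric_eq _ _ (ne_neg_nat hα) ?_ (neg_sq_re _)
  rw [norm_neg, norm_pow, Complex.norm_real, Real.norm_eq_abs]
  exact pow_lt_one₀ (abs_nonneg _) ht two_ne_zero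

/-- The Jacobi function is real analytic on the whole line. Together with `jacobiFunction_eq` this
determines it. -/
theorem jacobiFunction_analyticOnNhd {α : ℝ} (hα : -1 < α) (β : ℝ) (μ : ℂ) :
    AnalyticOnNhd ℝ (jacobiFunction α β μ) Set.univ := by
  intro t _
  have h1 := ((gaussHypergeometric_analyticOnNhd ((jacobiRho α β - Complex.I * μ) / 2)
    ((jacobiRho α β + Complex.I * μ) / 2) (ne_neg_nat hα)) _ (neg_sq_re (Real.sinh t))).restrictScalars
      (𝕜 := ℝ)
  have h2 : AnalyticAt ℝ (fun t : ℝ => -((Real.sinh t : ℂ) ^ 2)) t := by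
    have h3 : AnalyticAt ℝ Real.sinh t := Real.analyticAt_sinh
    exact (((Complex.ofRealCLM.analyticAt _).comp h3).pow 2).neg
  exact AnalyticAt.comp (f := fun t : ℝ => -((Real.sinh t : ℂ) ^ 2)) h1 h2

/-! Pfaff's transformation gives φ_{λ-iρ}(t) = (cosh t)^{iλ} ₂F₁(a, a-β; α+1; τ²) with a = -iλ/2 and
τ = tanh t (`jacobiFunction_shift_eq`). For β = 0 and β = -1/2 the hypergeometric factor is a moment
E[u^{-2a}] = E[u^{iλ}] of a positive random variable u with values in [1-τ, 1+τ]. For β = 0, u =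
|1+τX| with X rotation invariant in the unit disc and |X|² of law Beta(1, α). For β = -1/2, u = 1+τX
with X symmetric on [-1, 1] and X² of law Beta(1/2, α+1/2). For β = 1 the disc variable serves
again, with the complex weight W = conj(1+τX). In all cases the difference to be bounded is E[(cosh
t)^{iλ}(u^{iλ}-1)W], with W = 1 in the first two.

The factor 1/√α comes from the concentration of u at 1: E[log² u] ≤ 32τ²/(α+1)
(`IsJacobiVariable.integral_log_sq_le`). This follows from p² log² x ≤ x^p + x^{-p} - 2, because the
moments of order ±p are hypergeometric values within τ²/(α+1) of 1. Since |u^{iλ}-1| ≤ |λ| |log u|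
max(1, u^{-Im λ}), it remains to pair log u, in the manner of Cauchy and Schwarz, with a bound for
the powers of cosh t and of v = u cosh t.

For (1), v lies in [e^{-t}, e^t]. For (2) with Im λ ≤ ρ, the powers are controlled by the exact
identity E[v^{-2(α+β₀+1)}] = 1 (`IsJacobiVariable.integral_cosh_mul_rpow`), where β₀ is the
parameter of u; it reflects ₂F₁(·, 0; ·; ·) = 1. For Im λ in [ρ, 2ρ], the symmetry φ_μ = φ_{-μ}
replaces λ by 2iρ-λ. There |λ| ≥ ρ is so large that both powers of cosh t may be compared with 1. -/

/-! ### Elementary inequalities for powers and logarithms. -/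

/-- Mean value inequality along the segment from 0 to w, on which |exp| is largest at an endpoint.
-/
theorem Complex.norm_exp_sub_one_le_mul_max (w : ℂ) :
    ‖Complex.exp w - 1‖ ≤ ‖w‖ * max 1 (Real.exp w.re) := by
  have h : ∀ x ∈ Set.Icc (0 : ℝ) 1, HasDerivWithinAt (fun x : ℝ => Complex.exp (x * w))
      (Complex.exp (x * w) * w) (Set.Icc 0 1) x := by
    intro x _
    have h1 : HasDerivAt (fun x : ℝ => (x : ℂ) * w) w x := by
      simpa using (Complex.ofRealCLM.hasDerivAt (x := x)).mul_const w
    exact h1.cexp.hasDerivWithinAt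
  have := norm_image_sub_le_of_norm_deriv_le_segment_01' h (C := ‖w‖ * max 1 (Real.exp w.re)) ?_
  · simpa using this
  · intro x hx
    rw [norm_mul, mul_comm, Complex.norm_exp]
    gcongr
    simp only [Complex.mul_re, Complex.ofReal_re, Complex.ofReal_im, zero_mul, sub_zero]
    rcases le_total w.re 0 with h0 | h0
    · refine le_max_of_le_left (Real.exp_le_one_iff.2 ?_)
      exact mul_nonpos_of_nonneg_of_nonpos hx.1 h0
    · refine le_max_of_le_right (Real.exp_le_exp.2 ?_)
      exact mul_le_of_le_one_left h0 hx.2.le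

theorem Complex.norm_ofReal_cpow_sub_one_le {x : ℝ} (hx : 0 < x) (w : ℂ) :
    ‖(x : ℂ) ^ w - 1‖ ≤ ‖w‖ * |Real.log x| * max 1 (x ^ w.re) := by
  have hx' : (x : ℂ) ≠ 0 := by exact_mod_cast hx.ne'
  have h := Complex.norm_exp_sub_one_le_mul_max ((Real.log x : ℂ) * w)
  rw [Complex.cpow_def_of_ne_zero hx', ← Complex.ofReal_log hx.le, Real.rpow_def_of_pos hx]
  refine h.trans_eq ?_
  rw [norm_mul, Complex.norm_real, Real.norm_eq_abs, Complex.re_ofReal_mul]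
  ring

/-- With y = p log x the right side is 2 cosh y - 2 = 4 sinh²(y/2), and |sinh s| ≥ |s|. This bounds
the second moment of a logarithm by moments of two opposite orders. -/
theorem Real.sq_mul_log_sq_le {x : ℝ} (hx : 0 < x) (p : ℝ) :
    p ^ 2 * Real.log x ^ 2 ≤ x ^ p + x ^ (-p) - 2 := by
  rw [Real.rpow_def_of_pos hx, Real.rpow_def_of_pos hx, ← mul_pow]
  set y := p * Real.log x with hy
  rw [mul_comm _ p, mul_neg, mul_comm _ p, ← hy]
  have h : |y / 2| ≤ |Real.sinh (y / 2)| := by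
    rw [Real.abs_sinh]
    exact Real.self_le_sinh_iff.2 (abs_nonneg _)
  have h1 := sq_le_sq.2 h
  have h2 := Real.cosh_two_mul (y / 2)
  have h3 := Real.cosh_sq (y / 2)
  rw [mul_div_cancel₀ _ two_ne_zero, Real.cosh_eq] at h2
  linarith

theorem Real.log_cosh_le (t : ℝ) : Real.log (Real.cosh t) ≤ t ^ 2 / 2 := by
  rw [Real.log_le_iff_le_exp (Real.cosh_pos t)]
  exact Real.cosh_le_exp_half_sq t

/-! ### Symmetry of the Jacobi function and its Pfaff form. -/

/-- Pfaff's form is not visibly symmetric in a and b, but the power series is; the identity theorem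
carries the symmetry from a neighbourhood of 0 to the half plane. -/
theorem gaussHypergeometric_symm (a b : ℂ) {c z : ℂ} (hc : ∀ k : ℕ, c ≠ -k) (hz : z.re < 1 / 2) :
    gaussHypergeometric a b c z = gaussHypergeometric b a c z := by
  refine AnalyticOnNhd.eqOn_of_preconnected_of_eventuallyEq
    (gaussHypergeometric_analyticOnNhd a b hc) (gaussHypergeometric_analyticOnNhd b a hc)
    (convex_halfSpace_re_lt _).isPreconnected (z₀ := 0) (by simp) ?_ hz
  filter_upwards [pfaff_small a b hc, pfaff_small b a hc] with w h1 h2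
  rw [h1, h2]
  simp only [ordinaryHypergeometric]
  rw [ordinaryHypergeometricSeries_symm]

theorem jacobiFunction_neg {α : ℝ} (hα : -1 < α) (β : ℝ) (μ : ℂ) (t : ℝ) :
    jacobiFunction α β (-μ) t = jacobiFunction α β μ t := by
  unfold jacobiFunction
  rw [gaussHypergeometric_symm _ _ (ne_neg_nat hα) (neg_sq_re _)]
  congr 2 <;> ring

theorem gaussHypergeometric_neg_sinh_sq (a b c : ℂ) (t : ℝ) :
    gaussHypergeometric a b c (-((Real.sinh t : ℂ) ^ 2)) =
      (Real.cosh t : ℂ) ^ (-2 * a) * ₂F₁ a (c - b) c ((Real.tanh t : ℂ) ^ 2) := by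
  have hc : (Real.cosh t : ℂ) ≠ 0 := by exact_mod_cast (Real.cosh_pos t).ne'
  have h1 : (1 - -((Real.sinh t : ℂ) ^ 2)) = (Real.cosh t : ℂ) ^ 2 := by
    have := Real.cosh_sq t
    have h : (Real.cosh t : ℂ) ^ 2 = (Real.sinh t : ℂ) ^ 2 + 1 := by exact_mod_cast this
    rw [h]; ring
  have h2 : (-((Real.sinh t : ℂ) ^ 2)) / (-((Real.sinh t : ℂ) ^ 2) - 1) =
      (Real.tanh t : ℂ) ^ 2 := by
    rw [← neg_sub 1, h1, neg_div_neg_eq, Real.tanh_eq_sinh_div_cosh, Complex.ofReal_div, div_pow]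
  rw [gaussHypergeometric, h1, h2, ← Complex.ofReal_pow]
  congr 1
  rw [pow_two, Complex.ofReal_mul, Complex.mul_cpow_ofReal_nonneg (Real.cosh_pos t).le
    (Real.cosh_pos t).le, ← Complex.cpow_add _ _ hc]
  congr 1; ring

theorem jacobiFunction_shift_eq (α β t : ℝ) (lam : ℂ) :
    jacobiFunction α β (lam - Complex.I * jacobiRho α β) t =
      (Real.cosh t : ℂ) ^ (Complex.I * lam) *
        ₂F₁ (-(Complex.I * lam) / 2) (-(Complex.I * lam) / 2 - β) (α + 1 : ℂ)
          ((Real.tanh t : ℂ) ^ 2) := by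
  have hI := Complex.I_sq
  rw [jacobiFunction, gaussHypergeometric_neg_sinh_sq]
  have e1 : ((jacobiRho α β : ℂ) - Complex.I * (lam - Complex.I * jacobiRho α β)) / 2 =
      -(Complex.I * lam) / 2 := by linear_combination (jacobiRho α β : ℂ) / 2 * hI
  have e2 : (α + 1 : ℂ) - ((jacobiRho α β : ℂ) + Complex.I * (lam - Complex.I * jacobiRho α β)) / 2
      = -(Complex.I * lam) / 2 - β := by
    have : (jacobiRho α β : ℂ) = α + β + 1 := by simp [jacobiRho]
    linear_combination (jacobiRho α β : ℂ) / 2 * hI - this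
  rw [e1, e2]
  congr 2
  ring

/-! ### Distance of the hypergeometric series from 1 for small parameters. -/

theorem norm_ascPochhammer_eval_le {a : ℂ} {r : ℝ} (h : ‖a‖ ≤ r) (n : ℕ) :
    ‖(ascPochhammer ℂ n).eval a‖ ≤ (ascPochhammer ℝ n).eval r := by
  induction n with
  | zero => simp
  | succ n ih =>
    rw [ascPochhammer_succ_eval, ascPochhammer_succ_eval, norm_mul]
    have : ‖a + n‖ ≤ r + n := (norm_add_le _ _).trans (by simpa using h)
    gcongr
    exact (norm_nonneg _).trans ih

/-- The Gauss series `∑ (1/8)ₙ (5/8)ₙ / (n!)²`. -/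
noncomputable def gaussMajorant (n : ℕ) : ℝ :=
  (ascPochhammer ℝ n).eval (1 / 8) * (ascPochhammer ℝ n).eval (5 / 8) / (n.factorial : ℝ) ^ 2

theorem gaussMajorant_nonneg (n : ℕ) : 0 ≤ gaussMajorant n := by
  have h1 := ascPochhammer_pos n (1 / 8 : ℝ) (by norm_num)
  have h2 := ascPochhammer_pos n (5 / 8 : ℝ) (by norm_num)
  unfold gaussMajorant
  positivity

theorem gaussMajorant_succ (n : ℕ) : gaussMajorant (n + 1) =
    gaussMajorant n * ((1 / 8 + n) * (5 / 8 + n) / ((n : ℝ) + 1) ^ 2) := by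
  unfold gaussMajorant
  rw [ascPochhammer_succ_eval, ascPochhammer_succ_eval, Nat.factorial_succ]
  push_cast
  have : (n.factorial : ℝ) ≠ 0 := by positivity
  field_simp

/-- The series converges because 1/8 + 5/8 < 1. The second term dominates the tail and makes the
induction close: with factor K the step needs K(N/4 + 11/64) ≥ N + 2, and K = 128/11 gives equality
at N = 0. The base case is 10/11 ≤ 1. -/
theorem sum_gaussMajorant_le (N : ℕ) :
    ∑ n ∈ Finset.range N, gaussMajorant (n + 1) + 128 / 11 * (N + 1) * gaussMajorant (N + 1) ≤ 1 := by
  induction N with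
  | zero => norm_num [gaussMajorant]
  | succ N ih =>
    refine le_trans ?_ ih
    rw [Finset.sum_range_succ, gaussMajorant_succ (N + 1)]
    have h := gaussMajorant_nonneg (N + 1)
    set g := gaussMajorant (N + 1)
    push_cast
    have : 1 + 128 / 11 * (((N : ℝ) + 1 + 1) * ((1 / 8 + (N + 1)) * (5 / 8 + (N + 1)) /
        ((N : ℝ) + 1 + 1) ^ 2)) ≤ 128 / 11 * (N + 1) := by
      have hN : (0 : ℝ) ≤ N := N.cast_nonneg
      have e : ((N : ℝ) + 1 + 1) * ((1 / 8 + (N + 1)) * (5 / 8 + (N + 1)) /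
        ((N : ℝ) + 1 + 1) ^ 2) = (1 / 8 + (N + 1)) * (5 / 8 + (N + 1)) / (N + 2) := by
        field_simp; ring
      rw [e, ← le_sub_iff_add_le', ← le_div_iff₀' (by norm_num), div_le_iff₀ (by positivity)]
      nlinarith
    nlinarith

theorem norm_ordinaryHypergeometric_sub_one_le {a b : ℂ} (ha : ‖a‖ ≤ 1 / 8) (hb : ‖b‖ ≤ 5 / 8)
    {α y : ℝ} (hα : 0 < α) (hy : 0 ≤ y) (hy1 : y ≤ 1) :
    ‖₂F₁ a b (α + 1 : ℂ) (y : ℂ) - 1‖ ≤ y / (α + 1) := by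
  rw [ordinaryHypergeometric_eq_tsum]
  set T : ℕ → ℂ := fun n => ((n.factorial : ℂ)⁻¹ * (ascPochhammer ℂ n).eval a *
    (ascPochhammer ℂ n).eval b * ((ascPochhammer ℂ n).eval (α + 1 : ℂ))⁻¹) • (y : ℂ) ^ n with hT
  -- The first Pochhammer factor α + 1 is kept, as the source of the decay in α; each later factor α
  -- + 1 + k is only bounded below by k + 1.
  have hpoch : ∀ n : ℕ, (α + 1) * ((n + 1).factorial : ℝ) ≤
      ‖(ascPochhammer ℂ (n + 1)).eval (α + 1 : ℂ)‖ := by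
    intro n
    induction n with
    | zero =>
      have : ‖(α + 1 : ℂ)‖ = α + 1 := by
        rw [← Complex.ofReal_one, ← Complex.ofReal_add, Complex.norm_real]
        exact abs_of_pos (by linarith)
      simp [this]
    | succ n ih =>
      rw [ascPochhammer_succ_eval, norm_mul, Nat.factorial_succ]
      have : ‖(α + 1 : ℂ) + (n + 1 : ℕ)‖ = α + 1 + (n + 1) := by
        rw [← Complex.ofReal_one, ← Complex.ofReal_add, ← Complex.ofReal_natCast,
          ← Complex.ofReal_add, Complex.norm_real, Real.norm_of_nonneg (by positivity)]
        push_cast; ring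
      rw [this]
      calc (α + 1) * (((n + 1 + 1 : ℕ) * (n + 1).factorial : ℕ) : ℝ)
          = ((α + 1) * ((n + 1).factorial : ℝ)) * (n + 2) := by push_cast; ring
        _ ≤ _ := mul_le_mul ih (by linarith) (by positivity) (norm_nonneg _)
  have hb : ∀ n, ‖T (n + 1)‖ ≤ y / (α + 1) * gaussMajorant (n + 1) := by
    intro n
    simp only [hT, smul_eq_mul, norm_mul, norm_inv, norm_pow, Complex.norm_natCast,
      Complex.norm_real, Real.norm_of_nonneg hy]
    have h1 := norm_ascPochhammer_eval_le ha (n + 1)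
    have h2 := norm_ascPochhammer_eval_le hb (n + 1)
    have p1 := ascPochhammer_pos (n + 1) (1 / 8 : ℝ) (by norm_num)
    have p2 := ascPochhammer_pos (n + 1) (5 / 8 : ℝ) (by norm_num)
    have h3 : y ^ (n + 1) ≤ y := by
      rw [pow_succ]; exact mul_le_of_le_one_left hy (pow_le_one₀ hy hy1)
    calc _ ≤ ((n + 1).factorial : ℝ)⁻¹ * (ascPochhammer ℝ (n + 1)).eval (1 / 8) *
          (ascPochhammer ℝ (n + 1)).eval (5 / 8) * ((α + 1) * ((n + 1).factorial : ℝ))⁻¹ * y := by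
          gcongr
          exact hpoch n
      _ = _ := by
        unfold gaussMajorant
        have : ((n + 1).factorial : ℝ) ≠ 0 := by positivity
        field_simp
  have hS : Summable fun n => gaussMajorant (n + 1) :=
    summable_of_sum_range_le (fun n => gaussMajorant_nonneg _) (c := 1) fun N => by
      have := sum_gaussMajorant_le N
      have h := gaussMajorant_nonneg (N + 1)
      have : 0 ≤ 128 / 11 * ((N : ℝ) + 1) * gaussMajorant (N + 1) := by positivity
      linarith
  have hS1 : ∑' n, gaussMajorant (n + 1) ≤ 1 :=
    Real.tsum_le_of_sum_range_le (fun n => gaussMajorant_nonneg _) fun N => by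
      have := sum_gaussMajorant_le N
      have h := gaussMajorant_nonneg (N + 1)
      have : 0 ≤ 128 / 11 * ((N : ℝ) + 1) * gaussMajorant (N + 1) := by positivity
      linarith
  have hTs : Summable fun n => T (n + 1) := Summable.of_norm_bounded (hS.mul_left _) hb
  have h0 : ∑' n, T n - 1 = ∑' n, T (n + 1) := by
    rw [((summable_nat_add_iff 1).1 hTs).tsum_eq_zero_add]
    simp [hT]
  change ‖∑' n, T n - 1‖ ≤ _
  rw [h0]
  calc _ ≤ ∑' n, y / (α + 1) * gaussMajorant (n + 1) :=
        tsum_of_norm_bounded (hS.mul_left _).hasSum hb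
    _ = y / (α + 1) * ∑' n, gaussMajorant (n + 1) := tsum_mul_left
    _ ≤ _ := mul_le_of_le_one_right (by positivity) hS1

/-! ### Moments of the beta law. -/

open MeasureTheory ProbabilityTheory in
theorem ae_betaMeasure_mem_Ioo (p q : ℝ) : ∀ᵐ x ∂betaMeasure p q, x ∈ Set.Ioo (0 : ℝ) 1 := by
  rw [betaMeasure, ae_withDensity_iff (f := betaPDF p q) (measurable_betaPDFReal p q).ennreal_ofReal]
  refine Eventually.of_forall fun x hx => ?_
  by_contra h
  exact hx (by rw [betaPDF_eq, if_neg (c := 0 < x ∧ x < 1) h, ENNReal.ofReal_zero])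

open MeasureTheory ProbabilityTheory in
theorem betaPDFReal_nonneg {p q : ℝ} (hp : 0 < p) (hq : 0 < q) (x : ℝ) : 0 ≤ betaPDFReal p q x := by
  by_cases h : 0 < x ∧ x < 1
  · exact (betaPDFReal_pos h.1 h.2 hp hq).le
  · rw [betaPDFReal, if_neg h]

open MeasureTheory ProbabilityTheory in
theorem integral_betaPDFReal {p q : ℝ} (hp : 0 < p) (hq : 0 < q) :
    ∫ x, betaPDFReal p q x = 1 := by
  rw [integral_eq_lintegral_of_nonneg_ae (Eventually.of_forall (betaPDFReal_nonneg hp hq))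
    (by fun_prop)]
  change (∫⁻ x, betaPDF p q x).toReal = 1
  rw [lintegral_betaPDF_eq_one hp hq, ENNReal.toReal_one]

open ProbabilityTheory in
theorem beta_add_nat {p q : ℝ} (hp : 0 < p) (hq : 0 < q) (n : ℕ) :
    beta (p + n) q = beta p q * ((ascPochhammer ℝ n).eval p / (ascPochhammer ℝ n).eval (p + q)) := by
  induction n with
  | zero => simp
  | succ n ih =>
    have h1 : 0 < p + n := by positivity
    have h2 : 0 < p + q + n := by positivity
    have h3 := ascPochhammer_pos n (p + q) (by positivity)
    have g1 := Real.Gamma_add_one h1.ne'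
    have g2 := Real.Gamma_add_one h2.ne'
    have g3 : 0 < Real.Gamma (p + q + n) := Real.Gamma_pos_of_pos h2
    rw [ascPochhammer_succ_eval, ascPochhammer_succ_eval]
    have e : beta (p + (n + 1 : ℕ)) q = beta (p + n) q * ((p + n) / (p + q + n)) := by
      unfold beta
      rw [show p + ((n + 1 : ℕ) : ℝ) = p + n + 1 by push_cast; ring,
        show p + n + 1 + q = p + q + n + 1 by ring, show p + n + q = p + q + n by ring, g1, g2]
      field_simp
    rw [e, ih]
    field_simp

open MeasureTheory ProbabilityTheory in
theorem integral_pow_betaMeasure {p q : ℝ} (hp : 0 < p) (hq : 0 < q) (n : ℕ) :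
    ∫ x, x ^ n ∂betaMeasure p q =
      (ascPochhammer ℝ n).eval p / (ascPochhammer ℝ n).eval (p + q) := by
  have hb := beta_pos hp hq
  have hbn := beta_pos (α := p + n) (β := q) (by positivity) hq
  have h : ∀ x, (betaPDF p q x).toReal • x ^ n =
      (beta (p + n) q / beta p q) * betaPDFReal (p + n) q x := by
    intro x
    rw [betaPDF, ENNReal.toReal_ofReal (betaPDFReal_nonneg hp hq x), betaPDFReal, betaPDFReal]
    split_ifs with hx
    · have hx' : x ^ (p + n - 1) = x ^ (p - 1) * x ^ n := by
        rw [show p + n - 1 = p - 1 + n by ring, Real.rpow_add_natCast hx.1.ne']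
      rw [hx', smul_eq_mul]
      field_simp
    · simp
  rw [betaMeasure, integral_withDensity_eq_integral_toReal_smul (f := betaPDF p q)
    (measurable_betaPDFReal p q).ennreal_ofReal (Eventually.of_forall fun x => ENNReal.ofReal_lt_top)]
  simp_rw [h]
  rw [integral_const_mul, integral_betaPDFReal (by positivity) hq, mul_one, beta_add_nat hp hq]
  field_simp

theorem ascPochhammer_eval_ofReal (x : ℝ) (n : ℕ) :
    (((ascPochhammer ℝ n).eval x : ℝ) : ℂ) = (ascPochhammer ℂ n).eval (x : ℂ) := by
  induction n with
  | zero => simp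
  | succ n ih => rw [ascPochhammer_succ_eval, ascPochhammer_succ_eval, ← ih]; push_cast; ring

/-! ### Integral representation over the disc. -/

-- Both factors are expanded in binomial series, and absolute convergence for τ < 1 allows termwise
-- integration. Orthogonality of the monomials leaves only the diagonal of the double series. With m
-- n = n!/(α+1)ₙ the result is a Gauss series.
open MeasureTheory in
theorem hasSum_integral_cpow_mul_cpow_conj {Ω : Type*} [MeasurableSpace Ω] {P : Measure Ω}
    [IsProbabilityMeasure P] {X : Ω → ℂ} (hX : Measurable X) (hX1 : ∀ᵐ ω ∂P, ‖X ω‖ ≤ 1)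
    {m : ℕ → ℂ} (hm : ∀ j k, ∫ ω, X ω ^ j * (starRingEnd ℂ (X ω)) ^ k ∂P = if j = k then m j else 0)
    (a b : ℂ) {τ : ℝ} (hτ : 0 ≤ τ) (hτ1 : τ < 1) :
    HasSum (fun n : ℕ => (ascPochhammer ℂ n).eval a * ((n.factorial : ℂ))⁻¹ *
      ((ascPochhammer ℂ n).eval b * ((n.factorial : ℂ))⁻¹) * (τ ^ 2 : ℂ) ^ n * m n)
      (∫ ω, (1 + τ * X ω) ^ (-a) * (1 + τ * starRingEnd ℂ (X ω)) ^ (-b) ∂P) := by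
  obtain ⟨A, hA⟩ : ∃ A : ℂ → ℕ → ℂ, ∀ a n,
      A a n = (ascPochhammer ℂ n).eval a * ((n.factorial : ℂ))⁻¹ := ⟨_, fun _ _ => rfl⟩
  have hbinom : ∀ a z : ℂ, ‖z‖ < 1 → HasSum (fun n => A a n * z ^ n) ((1 - z) ^ (-a)) := by
    intro a z hz
    simp_rw [hA]
    exact hasSum_binom a hz
  simp_rw [← hA]
  have hτn : ‖(τ : ℂ)‖ < 1 := by rwa [Complex.norm_real, Real.norm_of_nonneg hτ]
  have hs : ∀ a : ℂ, Summable fun n => ‖A a n * (τ : ℂ) ^ n‖ := fun a =>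
    (hbinom a _ hτn).summable.norm
  set F : ℕ × ℕ → Ω → ℂ := fun q ω => (A a q.1 * (-(τ * X ω)) ^ q.1) *
    (A b q.2 * (-(τ * starRingEnd ℂ (X ω))) ^ q.2) with hF
  have hFb : ∀ q, ∀ᵐ ω ∂P, ‖F q ω‖ ≤ ‖A a q.1 * (τ : ℂ) ^ q.1‖ * ‖A b q.2 * (τ : ℂ) ^ q.2‖ := by
    intro q
    filter_upwards [hX1] with ω h
    simp only [hF, norm_mul, norm_pow, norm_neg, RCLike.norm_conj]
    gcongr
    · exact mul_le_of_le_one_right (norm_nonneg _) h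
    · exact mul_le_of_le_one_right (norm_nonneg _) h
  have hFm : ∀ q, AEStronglyMeasurable (F q) P := fun q => by
    have : Measurable (F q) := by
      have := Complex.continuous_conj.measurable.comp hX
      simp only [Function.comp_def] at this
      fun_prop
    exact this.aestronglyMeasurable
  have hFi : ∀ q, Integrable (F q) P := fun q =>
    Integrable.of_bound (hFm q) _ (hFb q)
  have hsum : Summable fun q : ℕ × ℕ => ‖A a q.1 * (τ : ℂ) ^ q.1‖ * ‖A b q.2 * (τ : ℂ) ^ q.2‖ :=
    (hs a).mul_of_nonneg (hs b) (fun _ => norm_nonneg _) (fun _ => norm_nonneg _)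
  have hFs : Summable fun q => ∫ ω, ‖F q ω‖ ∂P := by
    refine Summable.of_nonneg_of_le (fun q => integral_nonneg fun _ => norm_nonneg _)
      (fun q => ?_) hsum
    refine (integral_mono_ae (hFi q).norm (integrable_const _) (hFb q)).trans_eq ?_
    simp
  have h := hasSum_integral_of_summable_integral_norm hFi hFs
  have hlim : ∫ ω, ∑' q, F q ω ∂P =
      ∫ ω, (1 + τ * X ω) ^ (-a) * (1 + τ * starRingEnd ℂ (X ω)) ^ (-b) ∂P := by
    refine integral_congr_ae ?_
    filter_upwards [hX1] with ω hω
    have hn : ‖(τ : ℂ) * X ω‖ < 1 := by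
      rw [norm_mul]
      exact (mul_le_of_le_one_right (norm_nonneg _) hω).trans_lt hτn
    have h1 := hbinom a (-(τ * X ω)) (by rwa [norm_neg])
    have h2 := hbinom b (-(τ * starRingEnd ℂ (X ω))) (by
      rw [norm_neg, norm_mul, RCLike.norm_conj, ← norm_mul]; exact hn)
    rw [sub_neg_eq_add] at h1 h2
    rw [← h1.tsum_eq, ← h2.tsum_eq,
      tsum_mul_tsum_of_summable_norm h1.summable.norm h2.summable.norm]
  have hint : ∀ q : ℕ × ℕ, ∫ ω, F q ω ∂P = A a q.1 * A b q.2 * (-τ) ^ (q.1 + q.2) *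
      (if q.1 = q.2 then m q.1 else 0) := by
    intro q
    rw [← hm, ← integral_const_mul]
    congr 1
    funext ω
    simp only [hF]
    rw [neg_mul_eq_neg_mul, neg_mul_eq_neg_mul, mul_pow, mul_pow, pow_add]
    ring
  rw [hlim] at h
  have hinj : Function.Injective fun n : ℕ => (n, n) := fun _ _ h => (Prod.mk.inj h).1
  have h0 : ∀ q ∉ Set.range (fun n : ℕ => (n, n)), ∫ ω, F q ω ∂P = 0 := by
    intro q hq
    rw [hint, if_neg, mul_zero]
    intro hqq
    exact hq ⟨q.1, by simp [Prod.ext_iff, hqq]⟩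
  have h2 := (hinj.hasSum_iff h0).2 h
  convert! h2 using 2 with n
  simp only [Function.comp_apply, hint, if_true]
  rw [← two_mul, pow_mul, neg_sq]

open MeasureTheory ProbabilityTheory in
/-- The product of a beta law for the squared radius and a uniform angle. -/
noncomputable def discMeasure (α : ℝ) : Measure (ℝ × UnitAddCircle) :=
  (betaMeasure 1 α).prod AddCircle.haarAddCircle

/-- The point of the disc with given squared radius and angle. -/
noncomputable def discPoint (ω : ℝ × UnitAddCircle) : ℂ := (√ω.1 : ℂ) * fourier 1 ω.2

open MeasureTheory ProbabilityTheory in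
theorem isProbabilityMeasure_discMeasure {α : ℝ} (hα : 0 < α) :
    IsProbabilityMeasure (discMeasure α) := by
  have := isProbabilityMeasureBeta one_pos hα
  unfold discMeasure
  infer_instance

theorem measurable_discPoint : Measurable discPoint := by
  have : Measurable fun x : UnitAddCircle => (fourier 1 x : ℂ) := (fourier 1).continuous.measurable
  unfold discPoint
  fun_prop

open MeasureTheory ProbabilityTheory in
theorem norm_discPoint_le {α : ℝ} (hα : 0 < α) : ∀ᵐ ω ∂discMeasure α, ‖discPoint ω‖ ≤ 1 := by
  have := isProbabilityMeasureBeta one_pos hα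
  have h : ∀ᵐ ω ∂discMeasure α, ω.1 ∈ Set.Ioo (0 : ℝ) 1 :=
    (Measure.quasiMeasurePreserving_fst).ae (ae_betaMeasure_mem_Ioo 1 α)
  filter_upwards [h] with ω hω
  rw [discPoint, norm_mul, Complex.norm_real, fourier_apply, Circle.norm_coe, mul_one,
    Real.norm_of_nonneg (Real.sqrt_nonneg _)]
  exact Real.sqrt_le_one.2 hω.2.le

theorem ascPochhammer_eval_one_complex (n : ℕ) : (ascPochhammer ℂ n).eval 1 = n.factorial := by
  exact_mod_cast ascPochhammer_eval_one ℂ n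

open MeasureTheory ProbabilityTheory in
theorem integral_discPoint {α : ℝ} (hα : 0 < α) (j k : ℕ) :
    ∫ ω, discPoint ω ^ j * (starRingEnd ℂ (discPoint ω)) ^ k ∂discMeasure α =
      if j = k then (j.factorial : ℂ) * ((ascPochhammer ℂ j).eval (α + 1 : ℂ))⁻¹ else 0 := by
  have := isProbabilityMeasureBeta one_pos hα
  have e : ∀ ω, discPoint ω ^ j * (starRingEnd ℂ (discPoint ω)) ^ k =
      (√ω.1 : ℂ) ^ (j + k) * fourier ((j : ℤ) - k) ω.2 := by
    intro ω
    have h1 : ∀ n : ℕ, (fourier (n : ℤ) ω.2 : ℂ) = fourier 1 ω.2 ^ n := by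
      intro n
      rw [fourier_apply, fourier_one, natCast_zsmul, AddCircle.toCircle_nsmul, Circle.coe_pow]
    rw [sub_eq_add_neg, fourier_add, fourier_neg, h1, h1, discPoint, map_mul, Complex.conj_ofReal,
      mul_pow, mul_pow, pow_add, map_pow]
    ring
  simp_rw [e]
  rw [discMeasure, integral_prod_mul (fun x : ℝ => (√x : ℂ) ^ (j + k))
    (fun y : UnitAddCircle => (fourier ((j : ℤ) - k) y : ℂ))]
  split_ifs with h
  · subst h
    have h1 : ∫ x, (√x : ℂ) ^ (j + j) ∂betaMeasure 1 α = ((∫ x, x ^ j ∂betaMeasure 1 α : ℝ) : ℂ) := by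
      rw [← integral_complex_ofReal]
      refine integral_congr_ae ?_
      filter_upwards [ae_betaMeasure_mem_Ioo 1 α] with x hx
      rw [← two_mul, pow_mul, ← Complex.ofReal_pow, Real.sq_sqrt hx.1.le, Complex.ofReal_pow]
    rw [h1, integral_pow_betaMeasure one_pos hα, Complex.ofReal_div, ascPochhammer_eval_ofReal,
      ascPochhammer_eval_ofReal]
    simp [div_eq_mul_inv, add_comm]
  · have h1 : ∫ y : UnitAddCircle, (fourier ((j : ℤ) - k) y : ℂ) ∂AddCircle.haarAddCircle = 0 := by
      have h2 := orthonormal_iff_ite.1 (orthonormal_fourier (T := (1 : ℝ))) k j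
      rw [if_neg (by exact_mod_cast Ne.symm h), ContinuousMap.inner_toLp] at h2
      rw [← h2]
      congr 1
      funext y
      rw [sub_eq_add_neg, fourier_add, fourier_neg]
    rw [h1, mul_zero]

open MeasureTheory in
theorem integral_disc_cpow {α : ℝ} (hα : 0 < α) (a b : ℂ) {τ : ℝ} (hτ : 0 ≤ τ) (hτ1 : τ < 1) :
    ∫ ω, (1 + τ * discPoint ω) ^ (-a) * (1 + τ * starRingEnd ℂ (discPoint ω)) ^ (-b)
      ∂discMeasure α = ₂F₁ a b (α + 1 : ℂ) ((τ : ℂ) ^ 2) := by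
  have := isProbabilityMeasure_discMeasure hα
  have h := hasSum_integral_cpow_mul_cpow_conj measurable_discPoint (norm_discPoint_le hα)
    (m := fun j => (j.factorial : ℂ) * ((ascPochhammer ℂ j).eval (α + 1 : ℂ))⁻¹)
    (integral_discPoint hα) a b hτ hτ1
  rw [← h.tsum_eq, ordinaryHypergeometric_eq_tsum]
  refine tsum_congr fun n => ?_
  have : (n.factorial : ℂ) ≠ 0 := by exact_mod_cast n.factorial_ne_zero
  rw [smul_eq_mul]
  field_simp

/-! ### Integral representation over the interval. -/

open MeasureTheory ProbabilityTheory in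
/-- The product of a beta law for the squared modulus and a fair sign. -/
noncomputable def signMeasure (α : ℝ) : Measure (ℝ × ℝ) :=
  (betaMeasure (1 / 2) (α + 1 / 2)).prod
    ((1 / 2 : ENNReal) • Measure.dirac 1 + (1 / 2 : ENNReal) • Measure.dirac (-1))

/-- The point of the interval with given squared modulus and sign. -/
noncomputable def signPoint (ω : ℝ × ℝ) : ℝ := √ω.1 * ω.2

theorem measurable_signPoint : Measurable signPoint := by
  unfold signPoint
  fun_prop

open MeasureTheory ProbabilityTheory in
theorem isProbabilityMeasure_fairSign : IsProbabilityMeasure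
    ((1 / 2 : ENNReal) • Measure.dirac (1 : ℝ) + (1 / 2 : ENNReal) • Measure.dirac (-1)) :=
  ⟨by simp [ENNReal.inv_two_add_inv_two]⟩

open MeasureTheory ProbabilityTheory in
theorem isProbabilityMeasure_signMeasure {α : ℝ} (hα : 0 < α) :
    IsProbabilityMeasure (signMeasure α) := by
  have := isProbabilityMeasureBeta (α := 1 / 2) (β := α + 1 / 2) (by norm_num) (by positivity)
  have := isProbabilityMeasure_fairSign
  unfold signMeasure
  infer_instance

open MeasureTheory ProbabilityTheory in
theorem abs_signPoint_le {α : ℝ} (hα : 0 < α) : ∀ᵐ ω ∂signMeasure α, |signPoint ω| ≤ 1 := by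
  have := isProbabilityMeasureBeta (α := 1 / 2) (β := α + 1 / 2) (by norm_num) (by positivity)
  have := isProbabilityMeasure_fairSign
  have h : ∀ᵐ ω ∂signMeasure α, ω.1 ∈ Set.Ioo (0 : ℝ) 1 :=
    (Measure.quasiMeasurePreserving_fst).ae (ae_betaMeasure_mem_Ioo _ _)
  have h' : ∀ᵐ x ∂((1 / 2 : ENNReal) • Measure.dirac (1 : ℝ) + (1 / 2 : ENNReal) •
      Measure.dirac (-1)), |x| ≤ 1 := by
    rw [ae_add_measure_iff]
    constructor
    · refine Measure.ae_smul_measure ?_ _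
      rw [ae_dirac_eq]; simp
    · refine Measure.ae_smul_measure ?_ _
      rw [ae_dirac_eq]; simp
  have h2 : ∀ᵐ ω ∂signMeasure α, |ω.2| ≤ 1 := (Measure.quasiMeasurePreserving_snd).ae h'
  filter_upwards [h, h2] with ω hω hω2
  rw [signPoint, abs_mul, abs_of_nonneg (Real.sqrt_nonneg _)]
  exact mul_le_one₀ (Real.sqrt_le_one.2 hω.2.le) (abs_nonneg _) hω2

open MeasureTheory ProbabilityTheory in
theorem integral_signPoint_pow {α : ℝ} (hα : 0 < α) (k : ℕ) :
    ∫ ω, (signPoint ω : ℂ) ^ k ∂signMeasure α =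
      (∫ x, (√x : ℂ) ^ k ∂betaMeasure (1 / 2) (α + 1 / 2)) * ((1 + (-1) ^ k) / 2) := by
  have := isProbabilityMeasureBeta (α := 1 / 2) (β := α + 1 / 2) (by norm_num) (by positivity)
  have := isProbabilityMeasure_fairSign
  have h : ∀ ω, (signPoint ω : ℂ) ^ k = (√ω.1 : ℂ) ^ k * (ω.2 : ℂ) ^ k := by
    intro ω
    rw [signPoint, Complex.ofReal_mul, mul_pow]
  simp_rw [h]
  rw [signMeasure, integral_prod_mul (fun x : ℝ => (√x : ℂ) ^ k) (fun y : ℝ => (y : ℂ) ^ k)]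
  congr 1
  rw [integral_add_measure, integral_smul_measure, integral_smul_measure, integral_dirac,
    integral_dirac]
  · simp; ring
  · exact (integrable_dirac (by simp)).smul_measure (by simp)
  · exact (integrable_dirac (by simp)).smul_measure (by simp)

theorem ascPochhammer_two_mul_eval (a : ℂ) (n : ℕ) : (ascPochhammer ℂ (2 * n)).eval (2 * a) =
    4 ^ n * (ascPochhammer ℂ n).eval a * (ascPochhammer ℂ n).eval (a + 1 / 2) := by
  induction n with
  | zero => simp
  | succ n ih =>
    rw [show 2 * (n + 1) = 2 * n + 1 + 1 by ring, ascPochhammer_succ_eval, ascPochhammer_succ_eval,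
      ih, ascPochhammer_succ_eval, ascPochhammer_succ_eval]
    push_cast; ring

theorem factorial_two_mul_eq_ascPochhammer (n : ℕ) : ((2 * n).factorial : ℂ) =
    4 ^ n * (ascPochhammer ℂ n).eval (1 / 2) * n.factorial := by
  have h := ascPochhammer_two_mul_eval (1 / 2) n
  rw [show (2 : ℂ) * (1 / 2) = 1 by norm_num, show (1 / 2 : ℂ) + 1 / 2 = 1 by norm_num] at h
  rw [ascPochhammer_eval_one_complex, ascPochhammer_eval_one_complex] at h
  exact h

-- The fair sign kills the odd terms of the binomial series. In the even ones the duplication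
-- formulas for (2a)₂ₙ and (2n)! apply, and the factor (1/2)ₙ from (2n)! cancels the numerator of
-- the beta moment (1/2)ₙ/(α+1)ₙ.
open MeasureTheory ProbabilityTheory in
theorem integral_sign_cpow {α : ℝ} (hα : 0 < α) (a : ℂ) {τ : ℝ} (hτ : 0 ≤ τ) (hτ1 : τ < 1) :
    ∫ ω, (1 + τ * (signPoint ω : ℂ)) ^ (-(2 * a)) ∂signMeasure α =
      ₂F₁ a (a + 1 / 2) (α + 1 : ℂ) ((τ : ℂ) ^ 2) := by
  have := isProbabilityMeasure_signMeasure hα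
  have hτn : ‖(τ : ℂ)‖ < 1 := by rwa [Complex.norm_real, Real.norm_of_nonneg hτ]
  set A : ℕ → ℂ := fun n => (ascPochhammer ℂ n).eval (2 * a) * ((n.factorial : ℂ))⁻¹ with hA
  have hs : Summable fun n => ‖A n * (τ : ℂ) ^ n‖ := (hasSum_binom (2 * a) hτn).summable.norm
  set F : ℕ → ℝ × ℝ → ℂ := fun q ω => A q * (-(τ * (signPoint ω : ℂ))) ^ q with hF
  have hFb : ∀ q, ∀ᵐ ω ∂signMeasure α, ‖F q ω‖ ≤ ‖A q * (τ : ℂ) ^ q‖ := by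
    intro q
    filter_upwards [abs_signPoint_le hα] with ω h
    simp only [hF, norm_mul, norm_pow, norm_neg]
    gcongr
    rw [Complex.norm_real (signPoint ω)]
    exact mul_le_of_le_one_right (norm_nonneg _) h
  have hFm : ∀ q, AEStronglyMeasurable (F q) (signMeasure α) := fun q => by
    have h := measurable_signPoint
    have : Measurable (F q) := by fun_prop
    exact this.aestronglyMeasurable
  have hFi : ∀ q, Integrable (F q) (signMeasure α) := fun q =>
    Integrable.of_bound (hFm q) _ (hFb q)
  have hFs : Summable fun q => ∫ ω, ‖F q ω‖ ∂signMeasure α := by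
    refine Summable.of_nonneg_of_le (fun q => integral_nonneg fun _ => norm_nonneg _)
      (fun q => ?_) hs
    refine (integral_mono_ae (hFi q).norm (integrable_const _) (hFb q)).trans_eq ?_
    simp
  have h := hasSum_integral_of_summable_integral_norm hFi hFs
  have hlim : ∫ ω, ∑' q, F q ω ∂signMeasure α =
      ∫ ω, (1 + τ * (signPoint ω : ℂ)) ^ (-(2 * a)) ∂signMeasure α := by
    refine integral_congr_ae ?_
    filter_upwards [abs_signPoint_le hα] with ω hω
    have h1 := hasSum_binom (2 * a) (z := -(τ * (signPoint ω : ℂ))) (by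
      rw [norm_neg, norm_mul, Complex.norm_real (signPoint ω)]
      exact (mul_le_of_le_one_right (norm_nonneg _) hω).trans_lt hτn)
    rw [sub_neg_eq_add] at h1
    exact h1.tsum_eq
  have hint : ∀ q : ℕ, ∫ ω, F q ω ∂signMeasure α = A q * (-τ) ^ q *
      ((∫ x, (√x : ℂ) ^ q ∂betaMeasure (1 / 2) (α + 1 / 2)) * ((1 + (-1) ^ q) / 2)) := by
    intro q
    rw [← integral_signPoint_pow hα, ← integral_const_mul]
    congr 1
    funext ω
    simp only [hF]
    rw [neg_mul_eq_neg_mul, mul_pow]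
    ring
  rw [hlim] at h
  have hinj : Function.Injective fun n : ℕ => 2 * n := fun _ _ h => by simpa using h
  have h0 : ∀ q ∉ Set.range (fun n : ℕ => 2 * n), ∫ ω, F q ω ∂signMeasure α = 0 := by
    intro q hq
    have : Odd q := by
      rw [← Nat.not_even_iff_odd]
      rintro ⟨r, rfl⟩
      exact hq ⟨r, by simp [two_mul]⟩
    rw [hint, this.neg_one_pow]
    simp
  have h2 := (hinj.hasSum_iff h0).2 h
  rw [← h2.tsum_eq, ordinaryHypergeometric_eq_tsum]
  refine tsum_congr fun n => ?_
  have h1 : ∫ x, (√x : ℂ) ^ (2 * n) ∂betaMeasure (1 / 2) (α + 1 / 2) =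
      ((∫ x, x ^ n ∂betaMeasure (1 / 2) (α + 1 / 2) : ℝ) : ℂ) := by
    rw [← integral_complex_ofReal]
    refine integral_congr_ae ?_
    filter_upwards [ae_betaMeasure_mem_Ioo (1 / 2) (α + 1 / 2)] with x hx
    rw [pow_mul, ← Complex.ofReal_pow, Real.sq_sqrt hx.1.le, Complex.ofReal_pow]
  have hf : (n.factorial : ℂ) ≠ 0 := by exact_mod_cast n.factorial_ne_zero
  have hp : (ascPochhammer ℂ n).eval (1 / 2 : ℂ) ≠ 0 := by
    intro h
    have h3 := factorial_two_mul_eq_ascPochhammer n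
    rw [h, mul_zero, zero_mul] at h3
    exact (2 * n).factorial_ne_zero (by exact_mod_cast h3)
  have hq : (1 / 2 : ℝ) + (α + 1 / 2) = α + 1 := by ring
  simp only [Function.comp_apply, hint]
  rw [h1, integral_pow_betaMeasure (by norm_num) (by positivity), hq, Complex.ofReal_div,
    ascPochhammer_eval_ofReal, ascPochhammer_eval_ofReal]
  simp only [hA]
  rw [ascPochhammer_two_mul_eval, factorial_two_mul_eq_ascPochhammer, pow_mul (-1 : ℂ), neg_one_sq,
    one_pow, pow_mul, neg_sq]
  push_cast
  rw [smul_eq_mul]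
  field_simp
  ring

theorem Complex.cpow_mul_conj_cpow {z : ℂ} (hz : 0 < z.re) (w : ℂ) :
    z ^ w * (starRingEnd ℂ z) ^ w = (‖z‖ : ℂ) ^ (2 * w) := by
  have h0 : z ≠ 0 := by
    rintro rfl
    simp at hz
  have h1 : starRingEnd ℂ z ≠ 0 := by simpa using h0
  have harg : z.arg ≠ Real.pi := by
    intro h
    have := (Complex.arg_eq_pi_iff.1 h).1
    linarith
  have h2 : (‖z‖ : ℂ) ≠ 0 := by simpa using h0
  rw [Complex.cpow_def_of_ne_zero h0, Complex.cpow_def_of_ne_zero h1,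
    Complex.cpow_def_of_ne_zero h2, Complex.log_conj _ harg, ← Complex.exp_add, ← add_mul,
    Complex.add_conj, Complex.log_re, ← Complex.ofReal_log (norm_nonneg _)]
  congr 1
  push_cast
  ring

theorem ordinaryHypergeometric_zero_left (b c z : ℂ) : ₂F₁ (0 : ℂ) b c z = 1 := by
  rw [ordinaryHypergeometric_eq_tsum]
  beta_reduce
  rw [tsum_eq_single 0]
  · simp
  · intro n hn
    simp [ascPochhammer_ne_zero_eval_zero _ hn]

/-! ### Moment bounds for Jacobi variables. -/

/-- A random variable `u ∈ [1 - τ, 1 + τ]` whose complex moments are the hypergeometric functions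
`₂F₁(a, a - β; α + 1; τ²)`. -/
structure IsJacobiVariable {Ω : Type*} [MeasurableSpace Ω] (P : MeasureTheory.Measure Ω)
    (α β τ : ℝ) (u : Ω → ℝ) : Prop where
  measurable : Measurable u
  mem_Icc : ∀ᵐ ω ∂P, u ω ∈ Set.Icc (1 - τ) (1 + τ)
  integral_cpow : ∀ a : ℂ, ∫ ω, (u ω : ℂ) ^ (-(2 * a)) ∂P =
    ₂F₁ a (a - β) (α + 1 : ℂ) ((τ : ℂ) ^ 2)

namespace IsJacobiVariable

open MeasureTheory

variable {Ω : Type*} [MeasurableSpace Ω] {P : Measure Ω} {α β τ : ℝ} {u : Ω → ℝ}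

theorem ae_pos (hu : IsJacobiVariable P α β τ u) (hτ1 : τ < 1) : ∀ᵐ ω ∂P, 0 < u ω := by
  filter_upwards [hu.mem_Icc] with ω h
  linarith [h.1]

theorem integrable_comp [IsProbabilityMeasure P] (hu : IsJacobiVariable P α β τ u) (hτ1 : τ < 1)
    {E : Type*} [NormedAddCommGroup E] {f : ℝ → E} (hm : StronglyMeasurable f)
    (hf : ContinuousOn f (Set.Ioi 0)) : Integrable (fun ω => f (u ω)) P := by
  obtain ⟨C, hC⟩ := isCompact_Icc.exists_bound_of_continuousOn
    (hf.mono fun x (hx : x ∈ Set.Icc (1 - τ) (1 + τ)) => lt_of_lt_of_le (by linarith) hx.1)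
  refine Integrable.of_bound (hm.comp_measurable hu.measurable).aestronglyMeasurable C ?_
  filter_upwards [hu.mem_Icc] with ω h using hC _ h

theorem integrable_rpow [IsProbabilityMeasure P] (hu : IsJacobiVariable P α β τ u) (hτ1 : τ < 1)
    (p : ℝ) : Integrable (fun ω => u ω ^ p) P :=
  hu.integrable_comp hτ1 (f := fun x : ℝ => x ^ p) (by fun_prop) fun x hx =>
    (Real.continuousAt_rpow_const x p (Or.inl (ne_of_gt hx))).continuousWithinAt

theorem integrable_log_sq [IsProbabilityMeasure P] (hu : IsJacobiVariable P α β τ u)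
    (hτ1 : τ < 1) : Integrable (fun ω => Real.log (u ω) ^ 2) P :=
  hu.integrable_comp hτ1 (f := fun x : ℝ => Real.log x ^ 2)
    (by exact (Real.measurable_log.pow_const 2).stronglyMeasurable)
    fun x hx => ((Real.continuousAt_log (ne_of_gt hx)).pow 2).continuousWithinAt

theorem integrable_cpow [IsProbabilityMeasure P] (hu : IsJacobiVariable P α β τ u)
    (hτ1 : τ < 1) (w : ℂ) : Integrable (fun ω => (u ω : ℂ) ^ w) P :=
  hu.integrable_comp hτ1 (f := fun x : ℝ => (x : ℂ) ^ w)
    (by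
      have : Measurable fun x : ℝ => (x : ℂ) ^ w := by fun_prop
      exact this.stronglyMeasurable)
    fun x hx => (Complex.continuousAt_ofReal_cpow_const x w (Or.inr (ne_of_gt hx))).continuousWithinAt

theorem integral_rpow (hu : IsJacobiVariable P α β τ u) (hτ1 : τ < 1) (p : ℝ) :
    ((∫ ω, u ω ^ p ∂P : ℝ) : ℂ) =
      ₂F₁ (-p / 2 : ℂ) (-p / 2 - β : ℂ) (α + 1 : ℂ) ((τ : ℂ) ^ 2) := by
  rw [← hu.integral_cpow, ← integral_complex_ofReal]
  refine integral_congr_ae ?_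
  filter_upwards [hu.ae_pos hτ1] with ω h
  rw [Complex.ofReal_cpow h.le]
  congr 1
  ring

theorem integral_log_sq_le [IsProbabilityMeasure P] (hu : IsJacobiVariable P α β τ u)
    (hα : 0 < α) (hβ : β ∈ Set.Icc (-1 / 2) (1 / 2)) (hτ : 0 ≤ τ) (hτ1 : τ < 1) :
    ∫ ω, Real.log (u ω) ^ 2 ∂P ≤ 32 * (τ ^ 2 / (α + 1)) := by
  -- The order 1/4 gives |a| = 1/8 and |b| ≤ 1/8 + 1/2 = 5/8, the parameters of `gaussMajorant`.
  -- Then (1/4)² E[log² u] ≤ 2τ²/(α+1), whence the constant 32.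
  have key : ∀ p : ℝ, |p| = 1 / 4 → ∫ ω, u ω ^ p ∂P - 1 ≤ τ ^ 2 / (α + 1) := by
    intro p hp
    have ha : ‖(-p / 2 : ℂ)‖ ≤ 1 / 8 := by
      rw [norm_div, norm_neg, Complex.norm_real, Real.norm_eq_abs, hp]
      norm_num
    have hb : ‖(-p / 2 - β : ℂ)‖ ≤ 5 / 8 := by
      refine (norm_sub_le _ _).trans ?_
      have : ‖(β : ℂ)‖ ≤ 1 / 2 := by
        rw [Complex.norm_real]
        exact abs_le.2 ⟨by linarith [hβ.1], hβ.2⟩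
      linarith
    have h := norm_ordinaryHypergeometric_sub_one_le ha hb hα (sq_nonneg τ) (by nlinarith)
    rw [Complex.ofReal_pow, ← hu.integral_rpow hτ1, ← Complex.ofReal_one, ← Complex.ofReal_sub,
      Complex.norm_real] at h
    exact (le_abs_self _).trans h
  have h1 := key (1 / 4) (by norm_num)
  have h2 := key (-(1 / 4)) (by norm_num)
  have hadd : Integrable (fun ω => u ω ^ (1 / 4 : ℝ) + u ω ^ (-(1 / 4 : ℝ))) P :=
    (hu.integrable_rpow hτ1 _).add (hu.integrable_rpow hτ1 _)
  have h3 : ∫ ω, (1 / 4 : ℝ) ^ 2 * Real.log (u ω) ^ 2 ∂P ≤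
      ∫ ω, (u ω ^ (1 / 4 : ℝ) + u ω ^ (-(1 / 4 : ℝ)) - 2) ∂P := by
    refine integral_mono_ae ((hu.integrable_log_sq hτ1).const_mul _)
      (hadd.sub (integrable_const _)) ?_
    filter_upwards [hu.ae_pos hτ1] with ω h using Real.sq_mul_log_sq_le h _
  rw [integral_const_mul, integral_sub hadd (integrable_const _), integral_add (hu.integrable_rpow hτ1 _) (hu.integrable_rpow hτ1 _)] at h3
  simp only [integral_const, probReal_univ, one_smul] at h3
  linarith

/-- By Pfaff's transformation the integral is the continuation of ₂F₁(α+β+1, 0; α+1; ·) at -sinh² t.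
A vanishing upper parameter makes it 1. -/
theorem integral_cosh_mul_rpow {t : ℝ} (hu : IsJacobiVariable P α β (Real.tanh t) u)
    (hα : 0 < α) : ∫ ω, (Real.cosh t * u ω) ^ (-(2 * (α + β + 1))) ∂P = 1 := by
  have hτ1 := Real.tanh_lt_one t
  have hc := Real.cosh_pos t
  have h1 : ∫ ω, (Real.cosh t * u ω) ^ (-(2 * (α + β + 1))) ∂P =
      Real.cosh t ^ (-(2 * (α + β + 1))) * ∫ ω, u ω ^ (-(2 * (α + β + 1))) ∂P := by
    rw [← integral_const_mul]
    refine integral_congr_ae ?_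
    filter_upwards [hu.ae_pos hτ1] with ω h
    exact Real.mul_rpow hc.le h.le
  have h2 : (((∫ ω, (Real.cosh t * u ω) ^ (-(2 * (α + β + 1))) ∂P : ℝ)) : ℂ) =
      gaussHypergeometric (α + β + 1) 0 (α + 1) (-((Real.sinh t : ℂ) ^ 2)) := by
    rw [h1, Complex.ofReal_mul, hu.integral_rpow hτ1, Complex.ofReal_cpow hc.le,
      gaussHypergeometric_neg_sinh_sq]
    congr 2 <;> push_cast <;> ring
  rw [gaussHypergeometric_symm _ _ (ne_neg_nat (by linarith)) (neg_sq_re _),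
    gaussHypergeometric_neg_sinh_sq, ordinaryHypergeometric_zero_left] at h2
  simpa using h2

/-- Young's inequality against the second moment of `log u`. -/
theorem norm_integral_le [IsProbabilityMeasure P] (hu : IsJacobiVariable P α β τ u)
    (hα : 0 < α) (hβ : β ∈ Set.Icc (-1 / 2) (1 / 2)) (hτ : 0 < τ) (hτ1 : τ < 1)
    {f : Ω → ℂ} {g : Ω → ℝ} {M B : ℝ} (hM : 0 ≤ M) (hg : Integrable (fun ω => g ω ^ 2) P)
    (hB : ∫ ω, g ω ^ 2 ∂P ≤ B) (hf : ∀ᵐ ω ∂P, ‖f ω‖ ≤ M * (|Real.log (u ω)| * g ω)) :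
    ‖∫ ω, f ω ∂P‖ ≤ M * ((32 + B) / 2) * (τ / √(α + 1)) := by
  set r := √(α + 1) with hr
  have hr0 : 0 < r := Real.sqrt_pos.2 (by linarith)
  have hr2 : r ^ 2 = α + 1 := Real.sq_sqrt (by linarith)
  -- This weight gives both halves of Young's inequality the order τ/√(α+1).
  set κ := r / τ with hκ
  have hκ0 : 0 < κ := by positivity
  have hi : Integrable (fun ω => M * ((κ * Real.log (u ω) ^ 2 + κ⁻¹ * g ω ^ 2) / 2)) P :=
    ((((hu.integrable_log_sq hτ1).const_mul κ).add (hg.const_mul _)).div_const 2).const_mul M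
  refine (norm_integral_le_of_norm_le hi ?_).trans ?_
  · filter_upwards [hf] with ω h
    refine h.trans (mul_le_mul_of_nonneg_left ?_ hM)
    have h1 : 0 ≤ κ⁻¹ * (κ * |Real.log (u ω)| - g ω) ^ 2 := by positivity
    have h2 : κ⁻¹ * (κ * |Real.log (u ω)| - g ω) ^ 2 = κ * |Real.log (u ω)| ^ 2 -
        2 * (|Real.log (u ω)| * g ω) + κ⁻¹ * g ω ^ 2 := by
      field_simp
      ring
    rw [sq_abs] at h2
    linarith
  · rw [integral_const_mul, integral_div, integral_add ((hu.integrable_log_sq hτ1).const_mul κ)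
      (hg.const_mul _), integral_const_mul, integral_const_mul, mul_assoc]
    refine mul_le_mul_of_nonneg_left ?_ hM
    have h1 := hu.integral_log_sq_le hα hβ hτ.le hτ1
    have h2 : κ * ∫ ω, Real.log (u ω) ^ 2 ∂P ≤ κ * (32 * (τ ^ 2 / (α + 1))) := by gcongr
    have h3 : κ⁻¹ * ∫ ω, g ω ^ 2 ∂P ≤ κ⁻¹ * B := by gcongr
    have h4 : κ * (32 * (τ ^ 2 / (α + 1))) = 32 * (τ / r) := by
      rw [← hr2, hκ]; field_simp
    have h5 : κ⁻¹ = τ / r := by rw [hκ, inv_div]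
    rw [h5] at h3 ⊢
    linarith

end IsJacobiVariable

/-! ### Bounds for real powers and for tanh. -/

theorem Real.rpow_neg_le_exp_abs_mul {x t : ℝ} (h1 : Real.exp (-t) ≤ x) (h2 : x ≤ Real.exp t)
    (s : ℝ) : x ^ (-s) ≤ Real.exp (|s| * t) := by
  have hx : 0 < x := (Real.exp_pos _).trans_le h1
  rw [Real.rpow_def_of_pos hx]
  refine Real.exp_le_exp.2 ?_
  have h3 : |Real.log x| ≤ t :=
    abs_le.2 ⟨(Real.le_log_iff_exp_le hx).2 h1, (Real.log_le_iff_le_exp hx).2 h2⟩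
  calc Real.log x * -s ≤ |Real.log x * -s| := le_abs_self _
    _ = |s| * |Real.log x| := by rw [abs_mul, abs_neg, mul_comm]
    _ ≤ |s| * t := by gcongr

theorem Real.rpow_neg_le_one_add {x s p : ℝ} (hx : 0 < x) (hs : 0 ≤ s) (hsp : s ≤ p) :
    x ^ (-s) ≤ 1 + x ^ (-p) := by
  rcases le_total x 1 with h | h
  · have := Real.rpow_le_rpow_of_exponent_ge hx h (neg_le_neg hsp)
    linarith
  · have := Real.rpow_le_one_of_one_le_of_nonpos h (neg_nonpos.2 hs)
    have := Real.rpow_nonneg hx.le (-p)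
    linarith

theorem Real.tanh_pos {t : ℝ} (ht : 0 < t) : 0 < Real.tanh t := by
  rw [Real.tanh_eq_sinh_div_cosh]
  exact div_pos (Real.sinh_pos_iff.2 ht) (Real.cosh_pos t)

theorem Real.tanh_le_min {t : ℝ} (ht : 0 ≤ t) : Real.tanh t ≤ min t 1 := by
  refine le_min ?_ (Real.tanh_lt_one t).le
  have h : ∀ x ∈ Set.Ici (0 : ℝ), 0 ≤ x * Real.cosh x - Real.sinh x := by
    have hmono : MonotoneOn (fun x => x * Real.cosh x - Real.sinh x) (Set.Ici 0) := by
      refine monotoneOn_of_deriv_nonneg (convex_Ici 0) (by fun_prop) (by fun_prop) fun x hx => ?_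
      rw [interior_Ici] at hx
      have hd : HasDerivAt (fun x => x * Real.cosh x - Real.sinh x)
          (1 * Real.cosh x + x * Real.sinh x - Real.cosh x) x :=
        ((hasDerivAt_id x).mul (Real.hasDerivAt_cosh x)).sub (Real.hasDerivAt_sinh x)
      rw [hd.deriv]
      have := mul_nonneg (le_of_lt hx) (Real.sinh_nonneg_iff.2 (le_of_lt hx))
      linarith
    intro x hx
    simpa using hmono Set.self_mem_Ici hx hx
  rw [Real.tanh_eq_sinh_div_cosh, div_le_iff₀ (Real.cosh_pos t)]
  linarith [h t ht]

theorem Complex.norm_cosh_cpow_I_mul (t : ℝ) (lam : ℂ) :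
    ‖(Real.cosh t : ℂ) ^ (Complex.I * lam)‖ = Real.cosh t ^ (-lam.im) := by
  rw [Complex.norm_cpow_eq_rpow_re_of_pos (Real.cosh_pos t)]
  simp

/-! ### Both estimates for any weighted moment representation. -/

namespace IsJacobiVariable

open MeasureTheory

variable {Ω : Type*} [MeasurableSpace Ω] {P : Measure Ω} {α β β₀ t : ℝ} {u : Ω → ℝ} {W : Ω → ℂ}

theorem cosh_mul_mem_Icc (hu : IsJacobiVariable P α β₀ (Real.tanh t) u) : ∀ᵐ ω ∂P,
    Real.cosh t * u ω ∈ Set.Icc (Real.exp (-t)) (Real.exp t) := by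
  have hc := Real.cosh_pos t
  have h : Real.cosh t * Real.tanh t = Real.sinh t := by
    rw [Real.tanh_eq_sinh_div_cosh]; field_simp
  filter_upwards [hu.mem_Icc] with ω hω
  rw [← Real.cosh_sub_sinh, ← Real.cosh_add_sinh, ← h]
  constructor
  · nlinarith [hω.1]
  · nlinarith [hω.2]

theorem jacobiFunction_sub_eq (lam : ℂ)
    (hF : ∀ a : ℂ, ₂F₁ a (a - β) (α + 1 : ℂ) ((Real.tanh t : ℂ) ^ 2) - 1 =
      ∫ ω, ((u ω : ℂ) ^ (-(2 * a)) - 1) * W ω ∂P) :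
    jacobiFunction α β (lam - Complex.I * jacobiRho α β) t - (Real.cosh t : ℂ) ^ (Complex.I * lam) =
      ∫ ω, (Real.cosh t : ℂ) ^ (Complex.I * lam) *
        (((u ω : ℂ) ^ (Complex.I * lam) - 1) * W ω) ∂P := by
  rw [jacobiFunction_shift_eq, integral_const_mul, ← mul_sub_one, hF]
  congr 4
  funext ω
  congr 3
  ring

/-- The power of cosh t is absorbed into the maximum, since cosh t · u, rather than u, is the
variable with range [e^{-t}, e^t] and a moment equal to 1. -/
theorem ae_norm_le (hu : IsJacobiVariable P α β₀ (Real.tanh t) u) (lam : ℂ) : ∀ᵐ ω ∂P,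
    ‖(Real.cosh t : ℂ) ^ (Complex.I * lam) * (((u ω : ℂ) ^ (Complex.I * lam) - 1) * W ω)‖ ≤
      ‖lam‖ * |Real.log (u ω)| *
        (max (Real.cosh t ^ (-lam.im)) ((Real.cosh t * u ω) ^ (-lam.im)) * ‖W ω‖) := by
  have hc := Real.cosh_pos t
  filter_upwards [hu.ae_pos (Real.tanh_lt_one t)] with ω h
  have h1 := Complex.norm_ofReal_cpow_sub_one_le h (Complex.I * lam)
  have h2 : (Complex.I * lam).re = -lam.im := by simp
  rw [h2, norm_mul, Complex.norm_I, one_mul] at h1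
  rw [norm_mul, norm_mul, Complex.norm_cosh_cpow_I_mul, Real.mul_rpow hc.le h.le]
  have h3 := Real.rpow_nonneg hc.le (-lam.im)
  calc _ ≤ Real.cosh t ^ (-lam.im) *
        (‖lam‖ * |Real.log (u ω)| * max 1 (u ω ^ (-lam.im)) * ‖W ω‖) := by gcongr
    _ = ‖lam‖ * |Real.log (u ω)| * (Real.cosh t ^ (-lam.im) * max 1 (u ω ^ (-lam.im)) * ‖W ω‖) := by
        ring
    _ = _ := by rw [mul_max_of_nonneg _ _ h3, mul_one]

/-- The parameter β₀ of u may differ from β, the weight W making up for the difference: W = 1 when β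
= β₀, and |W| = u < 2 when β = 1, β₀ = 0. The constant is 2 · (32 + 1)/2, from |W| ≤ 2 and g = 1. -/
theorem norm_jacobiFunction_sub_le [IsProbabilityMeasure P]
    (hu : IsJacobiVariable P α β₀ (Real.tanh t) u) (hα : 0 < α)
    (hβ₀ : β₀ ∈ Set.Icc (-1 / 2) (1 / 2)) (ht : 0 < t)
    (hF : ∀ a : ℂ, ₂F₁ a (a - β) (α + 1 : ℂ) ((Real.tanh t : ℂ) ^ 2) - 1 =
      ∫ ω, ((u ω : ℂ) ^ (-(2 * a)) - 1) * W ω ∂P)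
    (hW : ∀ᵐ ω ∂P, ‖W ω‖ ≤ 2) (lam : ℂ) :
    ‖jacobiFunction α β (lam - Complex.I * jacobiRho α β) t
        - (Real.cosh t : ℂ) ^ (Complex.I * lam)‖ ≤
      33 * (‖lam‖ * (Real.tanh t / √(α + 1))) * Real.exp (|lam.im| * t) := by
  rw [jacobiFunction_sub_eq lam hF]
  refine (hu.norm_integral_le hα hβ₀ (Real.tanh_pos ht) (Real.tanh_lt_one t)
    (g := fun _ => 1) (M := 2 * ‖lam‖ * Real.exp (|lam.im| * t)) (B := 1) (by positivity)
    (integrable_const _) (by simp) ?_).trans_eq (by ring)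
  have h1 := Real.one_le_cosh t
  have h2 : Real.cosh t ≤ Real.exp t := by
    rw [← Real.cosh_add_sinh]
    linarith [Real.sinh_pos_iff.2 ht]
  have h3 : Real.exp (-t) ≤ Real.cosh t := (Real.exp_le_one_iff.2 (by linarith)).trans h1
  filter_upwards [hu.ae_norm_le (W := W) lam, hW, hu.cosh_mul_mem_Icc] with ω h hw hv
  refine h.trans ?_
  have h4 : max (Real.cosh t ^ (-lam.im)) ((Real.cosh t * u ω) ^ (-lam.im)) ≤
      Real.exp (|lam.im| * t) :=
    max_le (Real.rpow_neg_le_exp_abs_mul h3 h2 _) (Real.rpow_neg_le_exp_abs_mul hv.1 hv.2 _)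
  calc _ ≤ ‖lam‖ * |Real.log (u ω)| * (Real.exp (|lam.im| * t) * 2) := by gcongr
    _ = _ := by ring

/-- With v = cosh t · u, the function g dominates the weighted powers of both cosh t and v,
uniformly in λ, and its second moment is bounded through E[v^{-2(α+β₀+1)}] = 1. -/
theorem norm_jacobiFunction_sub_le_of_im_mem [IsProbabilityMeasure P]
    (hu : IsJacobiVariable P α β₀ (Real.tanh t) u) (hα : 0 < α)
    (hβ₀ : β₀ ∈ Set.Icc (-1 / 2) (1 / 2)) (ht : 0 < t)
    (hF : ∀ a : ℂ, ₂F₁ a (a - β) (α + 1 : ℂ) ((Real.tanh t : ℂ) ^ 2) - 1 =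
      ∫ ω, ((u ω : ℂ) ^ (-(2 * a)) - 1) * W ω ∂P)
    (hW : ∀ᵐ ω ∂P, ‖W ω‖ ≤ 2) {lam : ℂ} (hlam : 0 ≤ lam.im)
    (hW' : ∀ᵐ ω ∂P, (Real.cosh t * u ω) ^ (-lam.im) * ‖W ω‖ ≤
      3 + (Real.cosh t * u ω) ^ (-(α + β₀ + 1))) :
    ‖jacobiFunction α β (lam - Complex.I * jacobiRho α β) t
        - (Real.cosh t : ℂ) ^ (Complex.I * lam)‖ ≤
      42 * (‖lam‖ * (Real.tanh t / √(α + 1))) := by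
  have hτ1 := Real.tanh_lt_one t
  have hc := Real.cosh_pos t
  have hint : ∀ p : ℝ, Integrable (fun ω => (Real.cosh t * u ω) ^ p) P := by
    intro p
    refine ((hu.integrable_rpow hτ1 p).const_mul (Real.cosh t ^ p)).congr ?_
    filter_upwards [hu.ae_pos hτ1] with ω h using (Real.mul_rpow hc.le h.le).symm
  have hg2 : ∀ᵐ ω ∂P, (5 + (Real.cosh t * u ω) ^ (-(α + β₀ + 1))) ^ 2 =
      25 + 10 * (Real.cosh t * u ω) ^ (-(α + β₀ + 1)) +
        (Real.cosh t * u ω) ^ (-(2 * (α + β₀ + 1))) := by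
    filter_upwards [hu.ae_pos hτ1] with ω h
    rw [show -(2 * (α + β₀ + 1)) = -(α + β₀ + 1) + -(α + β₀ + 1) by ring,
      Real.rpow_add (by positivity)]
    ring
  have hgi : Integrable (fun ω => (5 + (Real.cosh t * u ω) ^ (-(α + β₀ + 1))) ^ 2) P :=
    ((((integrable_const (25 : ℝ)).add ((hint _).const_mul 10)).add (hint _))).congr
      (hg2.mono fun ω h => h.symm)
  rw [jacobiFunction_sub_eq lam hF]
  -- B = 52 comes from (5 + x)² ≤ 50 + 2x² with E[x²] = 1, and 42 = (32 + 52)/2.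
  refine (hu.norm_integral_le hα hβ₀ (Real.tanh_pos ht) hτ1
    (g := fun ω => 5 + (Real.cosh t * u ω) ^ (-(α + β₀ + 1))) (M := ‖lam‖) (B := 52)
    (norm_nonneg _) hgi ?_ ?_).trans_eq (by ring)
  · have hi2 : Integrable (fun ω => 50 + 2 * (Real.cosh t * u ω) ^ (-(2 * (α + β₀ + 1)))) P :=
      (integrable_const _).add ((hint _).const_mul 2)
    refine (integral_mono_ae hgi hi2 ?_).trans_eq ?_
    · filter_upwards [hu.ae_pos hτ1] with ω h
      rw [show -(2 * (α + β₀ + 1)) = -(α + β₀ + 1) + -(α + β₀ + 1) by ring,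
        Real.rpow_add (by positivity)]
      nlinarith [sq_nonneg (5 - (Real.cosh t * u ω) ^ (-(α + β₀ + 1)))]
    · rw [integral_add (integrable_const _) ((hint _).const_mul 2), integral_const_mul,
        hu.integral_cosh_mul_rpow hα]
      simp
      norm_num
  · filter_upwards [hu.ae_norm_le (W := W) lam, hW, hW', hu.ae_pos hτ1] with ω h hw hw' hpos
    refine h.trans ?_
    rw [mul_assoc]
    gcongr
    have h1 : Real.cosh t ^ (-lam.im) ≤ 1 :=
      Real.rpow_le_one_of_one_le_of_nonpos (Real.one_le_cosh t) (by linarith)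
    have h2 : 0 ≤ (Real.cosh t * u ω) ^ (-(α + β₀ + 1)) := by positivity
    rw [max_mul_of_nonneg _ _ (norm_nonneg _)]
    refine max_le ?_ (by linarith)
    have := mul_le_mul h1 hw (norm_nonneg _) zero_le_one
    linarith

end IsJacobiVariable

/-! ### The representations for the three values of β. -/

open MeasureTheory in
theorem isJacobiVariable_sign {α τ : ℝ} (hα : 0 < α) (hτ : 0 ≤ τ) (hτ1 : τ < 1) :
    IsJacobiVariable (signMeasure α) α (-1 / 2) τ fun ω => 1 + τ * signPoint ω where
  measurable := (measurable_signPoint.const_mul τ).const_add 1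
  mem_Icc := by
    filter_upwards [abs_signPoint_le hα] with ω h
    have := abs_le.1 h
    constructor <;> nlinarith
  integral_cpow a := by
    have := integral_sign_cpow hα a hτ hτ1
    push_cast
    rw [this]
    congr 1
    ring

theorem one_add_mul_mem {z : ℂ} (hz : ‖z‖ ≤ 1) {τ : ℝ} (hτ : 0 ≤ τ) (hτ1 : τ < 1) :
    ‖1 + τ * z‖ ∈ Set.Icc (1 - τ) (1 + τ) ∧ 0 < (1 + τ * z).re := by
  have h : ‖τ * z‖ ≤ τ := by
    rw [norm_mul, Complex.norm_real, Real.norm_of_nonneg hτ]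
    exact mul_le_of_le_one_right hτ hz
  refine ⟨⟨?_, ?_⟩, ?_⟩
  · have := norm_sub_le_norm_add (1 : ℂ) (τ * z)
    rw [norm_one] at this
    linarith
  · have := norm_add_le (1 : ℂ) (τ * z)
    rw [norm_one] at this
    linarith
  · have := (abs_le.1 (Complex.abs_re_le_norm (τ * z))).1
    rw [Complex.add_re, Complex.one_re]
    linarith

open MeasureTheory in
theorem isJacobiVariable_disc {α τ : ℝ} (hα : 0 < α) (hτ : 0 ≤ τ) (hτ1 : τ < 1) :
    IsJacobiVariable (discMeasure α) α 0 τ fun ω => ‖1 + τ * discPoint ω‖ where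
  measurable := ((measurable_discPoint.const_mul _).const_add 1).norm
  mem_Icc := by
    filter_upwards [norm_discPoint_le hα] with ω h using (one_add_mul_mem h hτ hτ1).1
  integral_cpow a := by
    rw [Complex.ofReal_zero, sub_zero, ← integral_disc_cpow hα a a hτ hτ1]
    refine integral_congr_ae ?_
    filter_upwards [norm_discPoint_le hα] with ω h
    have := Complex.cpow_mul_conj_cpow (one_add_mul_mem h hτ hτ1).2 (-a)
    rw [map_add, map_one, map_mul, Complex.conj_ofReal] at this
    rw [this]
    congr 1
    ring

-- Lowering the second parameter from a to a - 1 multiplies the integrand of the disc representation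
-- by one factor conj(1+τX).
open MeasureTheory in
theorem integral_disc_cpow_mul_conj {α τ : ℝ} (hα : 0 < α) (hτ : 0 ≤ τ) (hτ1 : τ < 1) (a : ℂ) :
    ∫ ω, (‖1 + τ * discPoint ω‖ : ℂ) ^ (-(2 * a)) * starRingEnd ℂ (1 + τ * discPoint ω)
      ∂discMeasure α = ₂F₁ a (a - 1) (α + 1 : ℂ) ((τ : ℂ) ^ 2) := by
  rw [← integral_disc_cpow hα a (a - 1) hτ hτ1]
  refine integral_congr_ae ?_
  filter_upwards [norm_discPoint_le hα] with ω h
  have hpos := (one_add_mul_mem h hτ hτ1).2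
  have := Complex.cpow_mul_conj_cpow hpos (-a)
  have hne : starRingEnd ℂ (1 + τ * discPoint ω) ≠ 0 := by
    intro h0
    rw [map_eq_zero] at h0
    rw [h0] at hpos
    simp at hpos
  rw [← mul_neg, ← this, neg_sub, sub_eq_neg_add]
  have e : starRingEnd ℂ (1 + τ * discPoint ω) = 1 + τ * starRingEnd ℂ (discPoint ω) := by
    rw [map_add, map_one, map_mul, Complex.conj_ofReal]
  rw [e] at hne ⊢
  rw [Complex.cpow_add _ _ hne, Complex.cpow_one, mul_assoc]

open MeasureTheory in
theorem hypergeometric_sub_one_eq_of_isJacobiVariable {Ω : Type*} [MeasurableSpace Ω]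
    {P : Measure Ω} [IsProbabilityMeasure P] {α β τ : ℝ} {u : Ω → ℝ}
    (hu : IsJacobiVariable P α β τ u) (hτ1 : τ < 1) (a : ℂ) :
    ₂F₁ a (a - β) (α + 1 : ℂ) ((τ : ℂ) ^ 2) - 1 =
      ∫ ω, ((u ω : ℂ) ^ (-(2 * a)) - 1) * 1 ∂P := by
  simp_rw [mul_one]
  rw [integral_sub (hu.integrable_cpow hτ1 _) (integrable_const _), hu.integral_cpow]
  simp

open MeasureTheory in
theorem hypergeometric_sub_one_eq_disc {α τ : ℝ} (hα : 0 < α) (hτ : 0 ≤ τ) (hτ1 : τ < 1) (a : ℂ) :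
    ₂F₁ a (a - 1) (α + 1 : ℂ) ((τ : ℂ) ^ 2) - 1 =
      ∫ ω, ((‖1 + τ * discPoint ω‖ : ℂ) ^ (-(2 * a)) - 1) *
        starRingEnd ℂ (1 + τ * discPoint ω) ∂discMeasure α := by
  have := isProbabilityMeasure_discMeasure hα
  -- At a = 0 this says that the complex weight has mean 1, so the 1 may be moved under the
  -- integral.
  have h0 := integral_disc_cpow_mul_conj hα hτ hτ1 0
  rw [ordinaryHypergeometric_zero_left] at h0
  simp only [mul_zero, neg_zero, Complex.cpow_zero, one_mul] at h0
  have hi : Integrable (fun ω => starRingEnd ℂ (1 + τ * discPoint ω)) (discMeasure α) := by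
    refine Integrable.of_bound (C := 1 + τ) ?_ ?_
    · have : Measurable fun ω => starRingEnd ℂ (1 + τ * discPoint ω) :=
        Complex.continuous_conj.measurable.comp ((measurable_discPoint.const_mul _).const_add 1)
      exact this.aestronglyMeasurable
    · filter_upwards [norm_discPoint_le hα] with ω h
      rw [RCLike.norm_conj]
      exact (one_add_mul_mem h hτ hτ1).1.2
  simp_rw [sub_one_mul]
  rw [integral_sub ?_ hi, h0, integral_disc_cpow_mul_conj hα hτ hτ1]
  refine ((isJacobiVariable_disc hα hτ hτ1).integrable_cpow hτ1 (-(2 * a))).mul_bdd (c := 1 + τ)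
    hi.aestronglyMeasurable ?_
  filter_upwards [norm_discPoint_le hα] with ω h
  rw [RCLike.norm_conj]
  exact (one_add_mul_mem h hτ hτ1).1.2

/-- For β = 1, Im λ may reach ρ = α + 2, while the disc variable only controls the power p = α + 1.
The modulus u of the weight supplies the missing power: u ≤ cu lowers s by one when s ≥ 1, and for s
≤ 1 the product is at most u^{1-s} ≤ 2. -/
theorem rpow_neg_mul_le {c u s p : ℝ} (hc : 1 ≤ c) (hu : 0 < u) (hu2 : u ≤ 2) (hs : 0 ≤ s)
    (hsp : s ≤ p + 1) : (c * u) ^ (-s) * u ≤ 3 + (c * u) ^ (-p) := by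
  have hv : 0 < c * u := by positivity
  have h0 := Real.rpow_nonneg hv.le (-p)
  rcases le_total 1 s with h | h
  · have h1 : u ≤ c * u := le_mul_of_one_le_left hu.le hc
    calc (c * u) ^ (-s) * u ≤ (c * u) ^ (-s) * (c * u) := by gcongr
      _ = (c * u) ^ (-(s - 1)) := by
        rw [show -(s - 1) = -s + 1 by ring, Real.rpow_add_one hv.ne']
      _ ≤ 1 + (c * u) ^ (-p) := Real.rpow_neg_le_one_add hv (by linarith) (by linarith)
      _ ≤ _ := by linarith
  · have h1 : c ^ (-s) ≤ 1 := Real.rpow_le_one_of_one_le_of_nonpos hc (by linarith)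
    have h2 : u ^ (-s) * u = u ^ (1 - s) := by
      rw [show 1 - s = -s + 1 by ring, Real.rpow_add_one hu.ne']
    have h3 : u ^ (1 - s) ≤ 2 := by
      calc u ^ (1 - s) ≤ 2 ^ (1 - s) := Real.rpow_le_rpow hu.le hu2 (by linarith)
        _ ≤ 2 ^ (1 : ℝ) := Real.rpow_le_rpow_of_exponent_le (by norm_num) (by linarith)
        _ = 2 := Real.rpow_one 2
    have h4 : (c * u) ^ (-s) * u ≤ 2 := by
      rw [Real.mul_rpow (by linarith) hu.le, mul_assoc, h2]
      exact (mul_le_of_le_one_left (by positivity) h1).trans h3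
    linarith

theorem norm_jacobiFunction_sub_le_tanh {α β t : ℝ} (hβ : β = -1 / 2 ∨ β = 0 ∨ β = 1) (hα : 0 < α)
    (ht : 0 < t) (lam : ℂ) :
    ‖jacobiFunction α β (lam - Complex.I * jacobiRho α β) t
        - (Real.cosh t : ℂ) ^ (Complex.I * lam)‖ ≤
      33 * (‖lam‖ * (Real.tanh t / √(α + 1))) * Real.exp (|lam.im| * t) ∧
    (lam.im ∈ Set.Icc 0 (jacobiRho α β) →
      ‖jacobiFunction α β (lam - Complex.I * jacobiRho α β) t
          - (Real.cosh t : ℂ) ^ (Complex.I * lam)‖ ≤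
        42 * (‖lam‖ * (Real.tanh t / √(α + 1)))) := by
  have hτ := (Real.tanh_pos ht).le
  have hτ1 := Real.tanh_lt_one t
  have hc := Real.one_le_cosh t
  have hdisc := isJacobiVariable_disc hα hτ hτ1
  have hsign := isJacobiVariable_sign hα hτ hτ1
  have := isProbabilityMeasure_discMeasure hα
  have := isProbabilityMeasure_signMeasure hα
  have hone : ∀ v s p : ℝ, 0 < v → 0 ≤ s → s ≤ p → v ^ (-s) * ‖(1 : ℂ)‖ ≤ 3 + v ^ (-p) := by
    intro v s p hv hs hsp
    have := Real.rpow_neg_le_one_add hv hs hsp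
    rw [norm_one, mul_one]
    linarith
  rcases hβ with rfl | rfl | rfl
  · have hF := hypergeometric_sub_one_eq_of_isJacobiVariable hsign hτ1
    have hW : ∀ᵐ _ω ∂signMeasure α, ‖(1 : ℂ)‖ ≤ 2 := by simp
    refine ⟨hsign.norm_jacobiFunction_sub_le hα (by norm_num) ht hF hW lam, fun h => ?_⟩
    refine hsign.norm_jacobiFunction_sub_le_of_im_mem hα (by norm_num) ht hF hW h.1 ?_
    filter_upwards [hsign.ae_pos hτ1] with ω hω
    exact hone _ _ _ (by positivity) h.1 h.2
  · have hF := hypergeometric_sub_one_eq_of_isJacobiVariable hdisc hτ1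
    have hW : ∀ᵐ _ω ∂discMeasure α, ‖(1 : ℂ)‖ ≤ 2 := by simp
    refine ⟨hdisc.norm_jacobiFunction_sub_le hα (by norm_num) ht hF hW lam, fun h => ?_⟩
    refine hdisc.norm_jacobiFunction_sub_le_of_im_mem hα (by norm_num) ht hF hW h.1 ?_
    filter_upwards [hdisc.ae_pos hτ1] with ω hω
    exact hone _ _ _ (by positivity) h.1 h.2
  · have hF := hypergeometric_sub_one_eq_disc hα hτ hτ1
    have hW : ∀ᵐ ω ∂discMeasure α, ‖starRingEnd ℂ (1 + Real.tanh t * discPoint ω)‖ ≤ 2 := by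
      filter_upwards [hdisc.mem_Icc] with ω hω
      rw [RCLike.norm_conj]
      linarith [hω.2]
    rw [← Complex.ofReal_one] at hF
    refine ⟨hdisc.norm_jacobiFunction_sub_le hα (by norm_num) ht hF hW lam, fun h => ?_⟩
    refine hdisc.norm_jacobiFunction_sub_le_of_im_mem hα (by norm_num) ht hF hW h.1 ?_
    filter_upwards [hdisc.ae_pos hτ1, hW] with ω hω hω2
    rw [RCLike.norm_conj] at hω2 ⊢
    refine rpow_neg_mul_le hc hω hω2 h.1 ?_
    have := h.2
    unfold jacobiRho at this
    linarith

/-! ### Passage to min(t, 1)/√α and reflection of λ. -/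

theorem jacobiFunction_shift_zero (α β : ℝ) (lam : ℂ) :
    jacobiFunction α β (lam - Complex.I * jacobiRho α β) 0
        - (Real.cosh 0 : ℂ) ^ (Complex.I * lam) = 0 := by
  rw [jacobiFunction_shift_eq, Real.tanh_zero, Complex.ofReal_zero, zero_pow two_ne_zero,
    ordinaryHypergeometric_zero, mul_one, sub_self]

theorem tanh_div_sqrt_le {α t : ℝ} (hα : 0 < α) (ht : 0 ≤ t) :
    Real.tanh t / √(α + 1) ≤ min t 1 / √α := by
  have h1 : √α ≤ √(α + 1) := Real.sqrt_le_sqrt (by linarith)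
  have h2 := Real.tanh_le_min ht
  have h3 : 0 ≤ min t 1 := le_min ht zero_le_one
  have h4 := Real.sqrt_pos.2 hα
  gcongr

theorem norm_jacobiFunction_sub_le_min {α β t : ℝ} (hβ : β = -1 / 2 ∨ β = 0 ∨ β = 1) (hα : 0 < α)
    (ht : 0 ≤ t) (lam : ℂ) :
    ‖jacobiFunction α β (lam - Complex.I * jacobiRho α β) t
        - (Real.cosh t : ℂ) ^ (Complex.I * lam)‖ ≤
      33 * (‖lam‖ * min t 1 / √α) * Real.exp (|lam.im| * t) ∧
    (lam.im ∈ Set.Icc 0 (jacobiRho α β) →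
      ‖jacobiFunction α β (lam - Complex.I * jacobiRho α β) t
          - (Real.cosh t : ℂ) ^ (Complex.I * lam)‖ ≤
        42 * (‖lam‖ * min t 1 / √α)) := by
  rcases ht.eq_or_lt with rfl | ht'
  · rw [jacobiFunction_shift_zero, norm_zero]
    refine ⟨?_, fun _ => ?_⟩ <;> simp
  · have h := norm_jacobiFunction_sub_le_tanh hβ hα ht' lam
    have h1 := tanh_div_sqrt_le hα ht
    rw [mul_div_assoc]
    exact ⟨h.1.trans (by gcongr), fun h2 => (h.2 h2).trans (by gcongr)⟩

/-- Two bounds are interpolated: 2, and R t²/2 from log cosh t ≤ t²/2. The separate R lets λ and its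
reflection share the bound R = |λ|. -/
theorem norm_cosh_cpow_sub_one_le {α t : ℝ} (hα : 0 < α) (ht : 0 ≤ t) {lam : ℂ}
    (hlam : 0 ≤ lam.im) {R : ℝ} (hR : α + 1 / 2 ≤ R) (hlR : ‖lam‖ ≤ R) :
    ‖(Real.cosh t : ℂ) ^ (Complex.I * lam) - 1‖ ≤ 4 * (R * min t 1 / √α) := by
  have hc := Real.one_le_cosh t
  have hcp := Real.cosh_pos t
  have hs := Real.sqrt_pos.2 hα
  have hs2 := Real.sq_sqrt hα.le
  set s := √α
  have hle : Real.cosh t ^ (-lam.im) ≤ 1 :=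
    Real.rpow_le_one_of_one_le_of_nonpos hc (by linarith)
  have h2 : ‖(Real.cosh t : ℂ) ^ (Complex.I * lam) - 1‖ ≤ 2 := by
    refine (norm_sub_le _ _).trans ?_
    rw [Complex.norm_cosh_cpow_I_mul, norm_one]
    linarith
  have h3 : ‖(Real.cosh t : ℂ) ^ (Complex.I * lam) - 1‖ ≤ R * (t ^ 2 / 2) := by
    refine (Complex.norm_ofReal_cpow_sub_one_le hcp _).trans ?_
    have e : (Complex.I * lam).re = -lam.im := by simp
    rw [e, max_eq_left hle, mul_one, norm_mul, Complex.norm_I, one_mul,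
      abs_of_nonneg (Real.log_nonneg hc)]
    have := Real.log_cosh_le t
    have := Real.log_nonneg hc
    have : 0 ≤ R := by linarith
    gcongr
  have hR1 : 1 / 2 ≤ R := by linarith
  -- s ≤ s² + 1/4 ≤ α + 1/2 ≤ R.
  have hRs : s ≤ R := by nlinarith [sq_nonneg (s - 1 / 2)]
  rw [← mul_div_assoc, le_div_iff₀ hs]
  rcases le_total t 1 with h1 | h1
  · rw [min_eq_left h1]
    -- Below t = 1/√α the quadratic bound is the useful one. Above it the bound 2 suffices, since s
    -- ≤ s²t = αt ≤ Rt.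
    rcases le_total (t * s) 1 with h4 | h4
    · have : R * (t ^ 2 / 2) * s = R * t * (t * s) / 2 := by ring
      have h5 : R * t * (t * s) ≤ R * t := mul_le_of_le_one_right (by positivity) h4
      have h6 := mul_le_mul_of_nonneg_right h3 hs.le
      have : 0 ≤ R * t := by positivity
      linarith
    · have h5 : s ^ 2 * t ≤ R * t := by rw [hs2]; gcongr; linarith
      have h6 := mul_le_mul_of_nonneg_right h2 hs.le
      nlinarith
  · rw [min_eq_right h1]
    have h6 := mul_le_mul_of_nonneg_right h2 hs.le
    linarith

theorem norm_jacobiFunction_sub_le_of_im_mem_Icc {α β t : ℝ} (hβ : β = -1 / 2 ∨ β = 0 ∨ β = 1)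
    (hα : 0 < α) (ht : 0 ≤ t) {lam : ℂ} (hlam : lam.im ∈ Set.Icc 0 (2 * jacobiRho α β)) :
    ‖jacobiFunction α β (lam - Complex.I * jacobiRho α β) t
        - (Real.cosh t : ℂ) ^ (Complex.I * lam)‖ ≤ 50 * (‖lam‖ * min t 1 / √α) := by
  have hm : 0 ≤ min t 1 := le_min ht zero_le_one
  rcases le_total lam.im (jacobiRho α β) with h | h
  · refine ((norm_jacobiFunction_sub_le_min hβ hα ht lam).2 ⟨hlam.1, h⟩).trans ?_
    gcongr
    norm_num
  · set ρ := jacobiRho α β with hρ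
    have hρα : α + 1 / 2 ≤ ρ := by
      rw [hρ, jacobiRho]
      rcases hβ with rfl | rfl | rfl <;> linarith
    -- The reflection changes the sign of μ = λ - iρ and sends Im λ to 2ρ - Im λ ≤ ρ. It does not
    -- increase |λ|, because Im λ ≥ ρ.
    set lam' : ℂ := 2 * Complex.I * ρ - lam with hlam'
    have hre : lam'.re = -lam.re := by simp [hlam']
    have him : lam'.im = 2 * ρ - lam.im := by simp [hlam']
    have hnorm : ‖lam'‖ ≤ ‖lam‖ := by
      rw [← sq_le_sq₀ (norm_nonneg _) (norm_nonneg _), Complex.sq_norm, Complex.sq_norm,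
        Complex.normSq_apply, Complex.normSq_apply, hre, him]
      nlinarith
    have hR : α + 1 / 2 ≤ ‖lam‖ :=
      (hρα.trans h).trans ((le_abs_self _).trans (Complex.abs_im_le_norm _))
    have hsymm : jacobiFunction α β (lam - Complex.I * ρ) t =
        jacobiFunction α β (lam' - Complex.I * ρ) t := by
      rw [← jacobiFunction_neg (by linarith)]
      congr 1
      rw [hlam']
      ring
    have him0 : 0 ≤ lam'.im := by linarith [hlam.2]
    have h1 := (norm_jacobiFunction_sub_le_min hβ hα ht lam').2 ⟨him0, by linarith⟩
    have h2 := norm_cosh_cpow_sub_one_le hα ht hlam.1 hR le_rfl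
    have h3 := norm_cosh_cpow_sub_one_le hα ht him0 hR hnorm
    have h4 : ‖lam'‖ * min t 1 / √α ≤ ‖lam‖ * min t 1 / √α := by gcongr
    rw [hsymm]
    -- The three differences contribute 42, 4 and 4, whence 50.
    have e : jacobiFunction α β (lam' - Complex.I * ρ) t - (Real.cosh t : ℂ) ^ (Complex.I * lam) =
        (jacobiFunction α β (lam' - Complex.I * ρ) t - (Real.cosh t : ℂ) ^ (Complex.I * lam')) +
        ((Real.cosh t : ℂ) ^ (Complex.I * lam') - 1) -
        ((Real.cosh t : ℂ) ^ (Complex.I * lam) - 1) := by ring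
    rw [e]
    refine (norm_sub_le _ _).trans ?_
    have := norm_add_le (jacobiFunction α β (lam' - Complex.I * ρ) t -
      (Real.cosh t : ℂ) ^ (Complex.I * lam')) ((Real.cosh t : ℂ) ^ (Complex.I * lam') - 1)
    linarith

theorem corollary4p3 :
    ∃ C : ℝ, 0 < C ∧
      (∀ (α β t : ℝ) (lam : ℂ), β = -1 / 2 ∨ β = 0 ∨ β = 1 → 0 < α → 0 ≤ t →
        ‖jacobiFunction α β (lam - Complex.I * jacobiRho α β) t
            - (Real.cosh t : ℂ) ^ (Complex.I * lam)‖ ≤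
          C * (‖lam‖ * min t 1 / Real.sqrt α) * Real.exp (|lam.im| * t)) ∧
      (∀ (α β t : ℝ) (lam : ℂ), β = -1 / 2 ∨ β = 0 ∨ β = 1 → 0 < α → 0 ≤ t →
        lam.im ∈ Set.Icc 0 (2 * jacobiRho α β) →
        ‖jacobiFunction α β (lam - Complex.I * jacobiRho α β) t
            - (Real.cosh t : ℂ) ^ (Complex.I * lam)‖ ≤
          C * (‖lam‖ * min t 1 / Real.sqrt α)) := by
  refine ⟨50, by norm_num, fun α β t lam hβ hα ht => ?_, fun α β t lam hβ hα ht hlam =>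
    norm_jacobiFunction_sub_le_of_im_mem_Icc hβ hα ht hlam⟩
  have hm : 0 ≤ min t 1 := le_min ht zero_le_one
  refine (norm_jacobiFunction_sub_le_min hβ hα ht lam).1.trans ?_
  gcongr
  norm_num
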